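/- **Notation.** For an index $\mathbf{k}=(k_1,\dots,k_n)\in\mathbb{Z}_{\ge0}^n$ put $|\mathbf{k}|=k_1+\dots+k_n$, ${\rm dep}(\mathbf{k})=n$, $\mathbf{k}_-=(k_1,\dots,k_{n-1})$ and $\mathbf{1}_n=(1,\dots,1)$; sums, differences and $\ge$ are taken entrywise. An index is admissible if it is empty, or if all its entries are $\ge 1$ and its last entry is $\ge 2$. For an admissible index $\mathbf{k}$ of depth $n$ and $|z|\le 1$ put $$A(\mathbf{k};z)=2^n\sum_{\substack{0<m_1<\dots<m_n\\ m_j\equiv j\,(2)}}\frac{z^{m_n}}{m_1^{k_1}\cdots m_n^{k_n}},\qquad T(\mathbf{k})=A(\mathbf{k};1),\qquad A(\emptyset;z)=T(\emptyset)=1.$$ For $\sigma\in\mathbb{R}$ and $\mathbf{k}-\mathbf{1}_n\ge\mathbf{l}\ge 0$ the iterated log-tangent integral is defined by ${\rm Lt}_\emptyset^\emptyset=1$ and $${\rm Lt}_{\mathbf{k}}^{\mathbf{l}}(\sigma)=-\int_0^\sigma\theta^{l_n}\Bigl(\log\Bigl|\tan\frac{\theta}{2}\Bigr|\Bigr)^{k_n-1-l_n}{\rm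 Lt}_{\mathbf{k}_-}^{\mathbf{l}_-}(\theta)\,d\theta .$$ Let $\mathfrak{H}=\mathbb{Q}\langle e_0,e_1\rangle$ with the shuffle product $\sqcup\!\sqcup$ of words, extended bilinearly ($e_1^{\sqcup\!\sqcup r}$ is the $r$-fold shuffle power of $e_1$), and extend $A(e_1e_0^{k_1-1}\cdots e_1e_0^{k_n-1};z)=A(\mathbf{k};z)$ $\mathbb{Q}$-linearly. For $\mathbf{j},\mathbf{q},\mathbf{r}\in\mathbb{Z}_{\ge0}^n$ write $\mathbf{j}\preceq\mathbf{q}$ if $j_1+\dots+j_u\le q_1+\dots+q_u$ for all $u$, and put $$B_{\mathbf{q}}=\prod_{u=1}^n\frac{1}{q_1+\dots+q_u+u},\qquad C_{\mathbf{q}}^{\mathbf{j}}=(-1)^{|\mathbf{j}|}\prod_{u=1}^n\frac{(q_1+\dots+q_u-j_1-\dots-j_{u-1})!}{(q_1+\dots+q_u-j_1-\dots-j_u)!}\quad(\mathbf{j}\preceq\mathbf{q}),$$ $w_\emptyset^\emptyset=1$ and $w_{\mathbf{j}}^{\mathbf{r}}=(w_{\mathbf{j}_-}^{\mathbf{r}_-}\sqcup\!\sqcup\,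 e_1^{\sqcup\!\sqcup r_n})\,e_0^{1+j_n}$. Write $\mathbf{r}=(\mathbf{r}',\mathbf{r}'')$, where $\mathbf{r}'=(0,\dots,0)$ has depth $n'$ and $\mathbf{r}''$ is empty or has first entry $\ge1$; split $\mathbf{q}=(\mathbf{q}',\mathbf{q}'')$ in the same way; let $\overline{\mathbf{q}}$ be $\mathbf{q}''$ with $|\mathbf{q}'|+n'$ added to its first entry ($\overline{\mathbf{q}}=\emptyset$ if $\mathbf{q}''=\emptyset$). Define $$\tilde f_{\mathbf{q}}^{\mathbf{r}}(\sigma)=B_{\mathbf{q}'}\sum_{\mathbf{j}\preceq\overline{\mathbf{q}}}C_{\overline{\mathbf{q}}}^{\mathbf{j}}\,(i\sigma)^{|\mathbf{q}|+n'-|\mathbf{j}|}A(w_{\mathbf{j}}^{\mathbf{r}''};e^{i\sigma}),$$ $$\tilde F_{\mathbf{q}}^{\mathbf{r}}(\sigma)=\sum_{\substack{(\mathbf{q}^{(1)},\dots,\mathbf{q}^{(h)})=\mathbf{q}\\(\mathbf{r}^{(1)},\dots,\mathbf{r}^{(h)})=\mathbf{r}}}(-1)^{h-1}\Bigl(\prod_{j=1}^{h-1}\tilde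 f_{\mathbf{q}^{(j)}}^{\mathbf{r}^{(j)}}(0)\Bigr)\Bigl(\tilde f_{\mathbf{q}^{(h)}}^{\mathbf{r}^{(h)}}(\sigma)-\tilde f_{\mathbf{q}^{(h)}}^{\mathbf{r}^{(h)}}(0)\Bigr),$$ the sum being over all ways to cut $\mathbf{q}$ and $\mathbf{r}$ simultaneously into consecutive blocks with ${\rm dep}(\mathbf{q}^{(i)})={\rm dep}(\mathbf{r}^{(i)})\ge1$; and $\tilde F_\emptyset^\emptyset=1$. **Theorem.** Let $n\ge0$ and $\mathbf{k},\mathbf{l}\in\mathbb{Z}_{\ge0}^n$ with $\mathbf{k}-\mathbf{1}_n\ge\mathbf{l}$. (1) For all $\sigma\in[0,\pi]$, $${\rm Lt}_{\mathbf{k}}^{\mathbf{l}}(\sigma)=(-1)^{|\mathbf{k}|+n}i^{|\mathbf{l}|+n}\sum_{\mathbf{p}+\mathbf{r}=\mathbf{k}-\mathbf{1}_n-\mathbf{l}}\ \prod_{u=1}^n\frac{(k_u-1-l_u)!}{p_u!\,r_u!}\Bigl(-\frac{\pi}{2}i\Bigr)^{|\mathbf{p}|}\tilde F_{\mathbf{l}}^{\mathbf{r}}(\sigma),$$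 where the sum is over $\mathbf{p},\mathbf{r}\in\mathbb{Z}_{\ge0}^n$. (2) For every $\mathbf{r}\in\mathbb{Z}_{\ge0}^n$, the function $\tilde F_{\mathbf{l}}^{\mathbf{r}}$ on $[0,\pi]$ is a $\mathbb{Q}$-linear combination (with coefficients independent of $\sigma$) of the functions $(i\sigma)^mT(\mathbf{k}_1)A(\mathbf{k}_2;e^{i\sigma})$ with $m\ge0$, $\mathbf{k}_1,\mathbf{k}_2$ admissible, $m+|\mathbf{k}_1|+|\mathbf{k}_2|=|\mathbf{r}|+|\mathbf{l}|+n$ and ${\rm dep}(\mathbf{k}_1)+{\rm dep}(\mathbf{k}_2)=|\mathbf{r}|$. (3) Consequently the function ${\rm Lt}_{\mathbf{k}}^{\mathbf{l}}$ on $[0,\pi]$ is a $\mathbb{Q}$-linear combination of the functions $i^{|\mathbf{l}|+n}(i\sigma)^m(\pi i)^pT(\mathbf{k}_1)A(\mathbf{k}_2;e^{i\sigma})$ with $m,p\ge0$, $\mathbf{k}_1,\mathbf{k}_2$ admissible, $m+p+|\mathbf{k}_1|+|\mathbf{k}_2|=|\mathbf{k}|$ and $p+{\rm dep}(\mathbf{k}_1)+{\rm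 dep}(\mathbf{k}_2)=|\mathbf{k}-\mathbf{1}_n-\mathbf{l}|$. -/

import Mathlib

noncomputable section

namespace LogTan

/-! ### Indices, multiple `T`-values, multiple `A`-functions -/

/-- Admissible index: all entries are positive and the last one is at least `2`.
The empty index is admissible. Weight is `List.sum`, depth is `List.length`. -/
def Admissible (k : List ℕ) : Prop :=
  (∀ a ∈ k, 1 ≤ a) ∧ ∀ a ∈ k.getLast?, 2 ≤ a

/-- The tuples `0 < m₁ < ⋯ < mₙ` with `m_j ≡ j` modulo `2`
(positions are counted from `0` in `Fin n`, hence `j + 1` below). -/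
def ParityTuple (n : ℕ) : Type :=
  {m : Fin n → ℕ // StrictMono m ∧ ∀ j, 0 < m j ∧ m j ≡ (j : ℕ) + 1 [MOD 2]}

/-- The multiple `T`-value of an index, given by its series
(absolutely convergent for admissible indices). -/
def multipleT (k : List ℕ) : ℝ :=
  2 ^ k.length * ∑' m : ParityTuple k.length, 1 / ∏ j, (m.1 j : ℝ) ^ k.get j

/-- The summand exponent `mₙ`, the last entry of the tuple (`0` for the empty tuple). -/
def lastEntry : {n : ℕ} → (Fin n → ℕ) → ℕ
  | 0, _ => 0
  | n + 1, m => m (Fin.last n)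

/-- The multiple `A`-function of an index, given by its series. It converges absolutely for
`‖z‖ < 1`, and also for `‖z‖ = 1` when the index is admissible. For the empty index it is `1`. -/
def multipleA (k : List ℕ) (z : ℂ) : ℂ :=
  2 ^ k.length *
    ∑' m : ParityTuple k.length, z ^ lastEntry m.1 / ∏ j, (m.1 j : ℂ) ^ k.get j

/-! ### Iterated log-tangent integrals -/

/-- The iterated log-tangent integral `Lt_k^l(σ)`, for `l u + 1 ≤ k u`. -/
def Lt : {n : ℕ} → (k l : Fin n → ℕ) → ℝ → ℝ
  | 0, _, _, _ => 1
  | n + 1, k, l, σ =>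
      -∫ θ in (0 : ℝ)..σ,
        θ ^ l (Fin.last n) *
          Real.log |Real.tan (θ / 2)| ^ (k (Fin.last n) - 1 - l (Fin.last n)) *
          Lt (Fin.init k) (Fin.init l) θ

/-! ### The algebra `ℚ⟨e₀, e₁⟩` and the shuffle product -/

/-- The two letters. -/
inductive Letter : Type
  | e0 : Letter
  | e1 : Letter

/-- The noncommutative polynomial ring `ℚ⟨e₀, e₁⟩`. -/
abbrev NCPoly : Type := MonoidAlgebra ℚ (FreeMonoid Letter)

/-- A letter as an element of `ℚ⟨e₀, e₁⟩`. -/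
def letter (a : Letter) : NCPoly := MonoidAlgebra.of ℚ (FreeMonoid Letter) (FreeMonoid.of a)

/-- The shuffle product of two words. -/
def shuffleWord : List Letter → List Letter → NCPoly
  | [], v => MonoidAlgebra.of ℚ (FreeMonoid Letter) (FreeMonoid.ofList v)
  | a :: u, [] => MonoidAlgebra.of ℚ (FreeMonoid Letter) (FreeMonoid.ofList (a :: u))
  | a :: u, b :: v =>
      letter a * shuffleWord u (b :: v) + letter b * shuffleWord (a :: u) v

/-- The shuffle product on `ℚ⟨e₀, e₁⟩`, the bilinear extension of `shuffleWord`. -/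
def shuffle (x y : NCPoly) : NCPoly :=
  x.coeff.sum fun u a => y.coeff.sum fun v b =>
    (a * b) • shuffleWord (FreeMonoid.toList u) (FreeMonoid.toList v)

/-- The shuffle power `x ⧢ ⋯ ⧢ x` (`r` factors), equal to `1` for `r = 0`. -/
def shufflePow (x : NCPoly) : ℕ → NCPoly
  | 0 => 1
  | r + 1 => shuffle (shufflePow x r) x

/-- The word `e₁ e₀^(k₁-1) ⋯ e₁ e₀^(kₙ-1)` of an index. -/
def indexWord : List ℕ → List Letter
  | [] => []
  | a :: k => Letter.e1 :: (List.replicate (a - 1) Letter.e0 ++ indexWord k)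

/-- The number of letters `e₀` at the beginning of a word. -/
def leadingE0 : List Letter → ℕ
  | Letter.e0 :: w => leadingE0 w + 1
  | _ => 0

/-- The index of a word that is empty or begins with `e₁`, inverse to `indexWord`
(letters `e₀` at the beginning are ignored). -/
def wordIndex : List Letter → List ℕ
  | [] => []
  | Letter.e0 :: w => wordIndex w
  | Letter.e1 :: w => (leadingE0 w + 1) :: wordIndex w

theorem wordIndex_indexWord (k : List ℕ) (hk : ∀ a ∈ k, 1 ≤ a) :
    wordIndex (indexWord k) = k := by
  have h1 : ∀ (m : ℕ) (w : List Letter),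
      wordIndex (List.replicate m Letter.e0 ++ w) = wordIndex w := by
    intro m w
    induction m with
    | zero => simp
    | succ m ih => simpa [List.replicate_succ, wordIndex] using ih
  have h2 : ∀ (m : ℕ) (w : List Letter),
      leadingE0 (List.replicate m Letter.e0 ++ w) = m + leadingE0 w := by
    intro m w
    induction m with
    | zero => simp
    | succ m ih => simp [List.replicate_succ, leadingE0, ih]; omega
  have h3 : ∀ k : List ℕ, leadingE0 (indexWord k) = 0 := by
    intro k
    cases k <;> simp [indexWord, leadingE0]
  induction k with
  | nil => rfl
  | cons a k ih =>
    have ha : 1 ≤ a := hk a (by simp)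
    simp only [indexWord, wordIndex, h1, h2, h3]
    rw [ih fun b hb => hk b (by simp [hb])]
    congr 1
    omega

/-- The `ℚ`-linear map `A(·; z)`, applied to combinations of words that are empty or begin with
`e₁`, with `A(e₁ e₀^(k₁-1) ⋯ e₁ e₀^(kₙ-1); z) = A(k₁, …, kₙ; z)`. -/
def evalA (z : ℂ) : NCPoly →ₗ[ℚ] ℂ :=
  (Finsupp.linearCombination ℚ fun w : FreeMonoid Letter =>
      multipleA (wordIndex (FreeMonoid.toList w)) z) ∘ₗ
    (MonoidAlgebra.coeffLinearEquiv ℚ).toLinearMap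

/-! ### The functions `f̃` and `F̃`

A pair of indices `q, r` of the same depth is stored as the list of pairs `(q_u, r_u)`. -/

/-- `B_q = ∏_u 1 / (q₁ + ⋯ + q_u + u)`. -/
def coeffB (q : List ℕ) : ℚ :=
  ∏ u ∈ Finset.range q.length, 1 / (((q.take (u + 1)).sum + (u + 1) : ℕ) : ℚ)

/-- `j ⪯ q`: equal depth and `j₁ + ⋯ + j_u ≤ q₁ + ⋯ + q_u` for all `u`. -/
def Prec (j q : List ℕ) : Prop :=
  j.length = q.length ∧ ∀ u, (j.take u).sum ≤ (q.take u).sum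

/-- `C_q^j = ∏_u (-1)^(j_u) (q₁ + ⋯ + q_u - j₁ - ⋯ - j_{u-1})! / (q₁ + ⋯ + q_u - j₁ - ⋯ - j_u)!`,
for `j ⪯ q`. -/
def coeffC (q j : List ℕ) : ℚ :=
  (-1) ^ j.sum * ∏ u ∈ Finset.range q.length,
    ((Nat.factorial ((q.take (u + 1)).sum - (j.take u).sum) : ℕ) : ℚ) /
      ((Nat.factorial ((q.take (u + 1)).sum - (j.take (u + 1)).sum) : ℕ) : ℚ)

/-- Enumerates the `j` of the same depth as `q` with `j₁ + ⋯ + j_u ≤ s + q₁ + ⋯ + q_u`. -/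
def precList : ℕ → List ℕ → List (List ℕ)
  | _, [] => [[]]
  | s, a :: q => (List.range (s + a + 1)).flatMap fun b =>
      (precList (s + a - b) q).map fun j => b :: j

/-- The finite set of all `j ⪯ q`. -/
def precSet (q : List ℕ) : Finset (List ℕ) := (precList 0 q).toFinset

theorem mem_precSet (q j : List ℕ) : j ∈ precSet q ↔ Prec j q := by
  have h : ∀ (q : List ℕ) (s : ℕ) (j : List ℕ), j ∈ precList s q ↔
      (j.length = q.length ∧ ∀ u, (j.take u).sum ≤ s + (q.take u).sum) := by
    intro q
    induction q with
    | nil =>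
      intro s j
      cases j <;> simp [precList]
    | cons a q ih =>
      intro s j
      cases j with
      | nil => simp [precList]
      | cons b j =>
        simp only [precList, List.mem_flatMap, List.mem_range, List.mem_map, List.cons.injEq,
          List.length_cons]
        constructor
        · rintro ⟨c, hc, j', hj', rfl, rfl⟩
          obtain ⟨h1, h2⟩ := (ih _ _).1 hj'
          refine ⟨by omega, fun u => ?_⟩
          cases u with
          | zero => simp
          | succ u =>
            have := h2 u
            simp only [List.take_succ_cons, List.sum_cons]
            omega
        · rintro ⟨h1, h2⟩
          have hb := h2 1
          simp only [List.take_succ_cons, List.sum_cons, List.take_zero, List.sum_nil] at hb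
          refine ⟨b, by omega, j, (ih _ _).2 ⟨by omega, fun u => ?_⟩, rfl, rfl⟩
          have := h2 (u + 1)
          simp only [List.take_succ_cons, List.sum_cons] at this
          omega
  simp [precSet, h, Prec]

/-- One step `x ↦ (x ⧢ e₁^{⧢ r}) e₀^(1+j)`; the argument is the pair `(j, r)`. -/
def wordStep (x : NCPoly) (jr : ℕ × ℕ) : NCPoly :=
  shuffle x (shufflePow (letter Letter.e1) jr.2) * letter Letter.e0 ^ (1 + jr.1)

/-- The element `w_j^r`: `w_∅^∅ = 1` and
`w_j^r = (w_{j₋}^{r₋} ⧢ e₁^{⧢ rₙ}) e₀^(1+jₙ)`. -/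
def wordW (j r : List ℕ) : NCPoly := (j.zip r).foldl wordStep 1

/-- The index `q̄`, from `q'` and `q''`: empty if `q''` is empty, and otherwise `q''` with
`|q'| + n'` added to its first entry. -/
def qBar (q' : List ℕ) : List ℕ → List ℕ
  | [] => []
  | a :: q'' => (q'.sum + q'.length + a) :: q''

/-- The function `f̃_q^r(σ)`. Here `L'` is the longest initial part of `L` with `r_u = 0`
and `L''` is the rest. -/
def fTilde (L : List (ℕ × ℕ)) (σ : ℝ) : ℂ :=
  let L' := L.takeWhile fun a => a.2 == 0
  let L'' := L.dropWhile fun a => a.2 == 0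
  let q' := L'.map Prod.fst
  let q'' := L''.map Prod.fst
  let r'' := L''.map Prod.snd
  (coeffB q' : ℂ) * ∑ j ∈ precSet (qBar q' q''),
    (coeffC (qBar q' q'') j : ℂ) *
      (Complex.I * (σ : ℂ)) ^ ((L.map Prod.fst).sum + L'.length - j.sum) *
      evalA (Complex.exp (Complex.I * (σ : ℂ))) (wordW j r'')

/-- Enumerates the ways to cut a list into consecutive nonempty blocks. -/
def blockList {α : Type*} : List α → List (List (List α))
  | [] => [[]]
  | a :: L => (blockList L).flatMap fun P =>
      match P with
      | [] => [[[a]]]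
      | b :: Q => [[a] :: b :: Q, (a :: b) :: Q]

/-- The finite set of all ways to cut `L` into consecutive nonempty blocks. -/
def blockSet (L : List (ℕ × ℕ)) : Finset (List (List (ℕ × ℕ))) := (blockList L).toFinset

theorem mem_blockSet (L : List (ℕ × ℕ)) (P : List (List (ℕ × ℕ))) :
    P ∈ blockSet L ↔ P.flatten = L ∧ ∀ b ∈ P, b ≠ [] := by
  have h : ∀ (L : List (ℕ × ℕ)) (P : List (List (ℕ × ℕ))),
      P ∈ blockList L ↔ P.flatten = L ∧ ∀ b ∈ P, b ≠ [] := by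
    intro L
    induction L with
    | nil =>
      intro P
      simp only [blockList, List.mem_singleton, List.flatten_eq_nil_iff]
      constructor
      · rintro rfl
        simp
      · rintro ⟨h1, h2⟩
        cases P with
        | nil => rfl
        | cons b P => exact absurd (h1 b (by simp)) (h2 b (by simp))
    | cons a L ih =>
      intro P
      simp only [blockList, List.mem_flatMap]
      constructor
      · rintro ⟨Q, hQ, hP⟩
        obtain ⟨h1, h2⟩ := (ih Q).1 hQ
        cases Q with
        | nil =>
          simp only [List.mem_singleton] at hP
          subst hP
          simp_all
        | cons b Q =>
          simp only [List.mem_cons, List.not_mem_nil, or_false] at hP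
          rcases hP with rfl | rfl
          · simp_all
          · simp_all
      · rintro ⟨h1, h2⟩
        cases P with
        | nil => simp at h1
        | cons c P =>
          cases c with
          | nil => exact absurd rfl (h2 [] (by simp))
          | cons x c =>
            simp only [List.flatten_cons, List.cons_append, List.cons.injEq] at h1
            obtain ⟨rfl, h1⟩ := h1
            cases c with
            | nil =>
              refine ⟨P, (ih P).2 ⟨by simpa using h1, fun b hb => h2 b (by simp [hb])⟩, ?_⟩
              cases P <;> simp
            | cons y c =>
              refine ⟨(y :: c) :: P, (ih _).2 ⟨by simpa using h1, ?_⟩, by simp⟩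
              intro b hb
              rcases List.mem_cons.1 hb with rfl | hb
              · simp
              · exact h2 b (by simp [hb])
  simp [blockSet, h]

/-- The function `F̃_q^r(σ)` for the list `L` of pairs `(q_u, r_u)`; it is `1` for the
empty list. -/
def FTildeList (L : List (ℕ × ℕ)) (σ : ℝ) : ℂ :=
  if L = [] then 1
  else ∑ P ∈ blockSet L,
    (-1) ^ (P.length - 1) * (P.dropLast.map fun b => fTilde b 0).prod *
      (fTilde (P.getLastD []) σ - fTilde (P.getLastD []) 0)

/-- The function `F̃_q^r(σ)`. -/
def FTilde {n : ℕ} (q r : Fin n → ℕ) (σ : ℝ) : ℂ :=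
  FTildeList (List.ofFn fun u => (q u, r u)) σ

/-! ### The families of products -/

/-- The functions `(iσ)^m T(k₁) A(k₂; e^{iσ})` of `σ ∈ [0, π]` with `k₁, k₂` admissible,
`m + |k₁| + |k₂| = wt` and `dep k₁ + dep k₂ = dp`. -/
def productsTA (wt dp : ℕ) : Set (Set.Icc (0 : ℝ) Real.pi → ℂ) :=
  {g | ∃ (m : ℕ) (k₁ k₂ : List ℕ), Admissible k₁ ∧ Admissible k₂ ∧
    m + k₁.sum + k₂.sum = wt ∧ k₁.length + k₂.length = dp ∧
    g = fun σ : Set.Icc (0 : ℝ) Real.pi =>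
      (Complex.I * ((σ : ℝ) : ℂ)) ^ m * (multipleT k₁ : ℂ) *
      multipleA k₂ (Complex.exp (Complex.I * ((σ : ℝ) : ℂ)))}

/-- The functions `i^e (iσ)^m (πi)^p T(k₁) A(k₂; e^{iσ})` of `σ ∈ [0, π]` with `k₁, k₂`
admissible, `m + p + |k₁| + |k₂| = wt` and `p + dep k₁ + dep k₂ = dp`. -/
def productsPiTA (e wt dp : ℕ) : Set (Set.Icc (0 : ℝ) Real.pi → ℂ) :=
  {g | ∃ (m p : ℕ) (k₁ k₂ : List ℕ), Admissible k₁ ∧ Admissible k₂ ∧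
    m + p + k₁.sum + k₂.sum = wt ∧ p + k₁.length + k₂.length = dp ∧
    g = fun σ : Set.Icc (0 : ℝ) Real.pi =>
      Complex.I ^ e * (Complex.I * ((σ : ℝ) : ℂ)) ^ m *
      ((Real.pi : ℂ) * Complex.I) ^ p * (multipleT k₁ : ℂ) *
      multipleA k₂ (Complex.exp (Complex.I * ((σ : ℝ) : ℂ)))}

end LogTan

end

namespace LogTan

open Letter

instance : DecidableEq Letter
  | e0, e0 => isTrue rfl
  | e1, e1 => isTrue rfl
  | e0, e1 => isFalse fun h => by cases h
  | e1, e0 => isFalse fun h => by cases h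

/-! ### Words and the shuffle product -/

/-- A word as an element of `ℚ⟨e₀, e₁⟩`. -/
noncomputable def wd (w : List Letter) : NCPoly :=
  MonoidAlgebra.of ℚ (FreeMonoid Letter) (FreeMonoid.ofList w)

theorem wd_nil : wd [] = 1 := by
  simp [wd, MonoidAlgebra.one_def]

theorem wd_append (u v : List Letter) : wd (u ++ v) = wd u * wd v := by
  simp only [wd, FreeMonoid.ofList_append, map_mul]

theorem letter_eq_wd (a : Letter) : letter a = wd [a] := rfl

theorem wd_cons (a : Letter) (u : List Letter) : wd (a :: u) = letter a * wd u := by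
  rw [letter_eq_wd, ← wd_append]; rfl

theorem wd_snoc (u : List Letter) (a : Letter) : wd (u ++ [a]) = wd u * letter a := by
  rw [letter_eq_wd, ← wd_append]

theorem shuffleWord_nil_left (v : List Letter) : shuffleWord [] v = wd v := by
  cases v <;> simp [shuffleWord, wd]

theorem shuffleWord_nil_right (v : List Letter) : shuffleWord v [] = wd v := by
  cases v <;> simp [shuffleWord, wd]

theorem shuffleWord_cons_cons (a b : Letter) (u v : List Letter) :
    shuffleWord (a :: u) (b :: v) =
      letter a * shuffleWord u (b :: v) + letter b * shuffleWord (a :: u) v := by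
  rw [shuffleWord]

theorem shuffleWord_snoc_snoc (a b : Letter) : ∀ u v : List Letter,
    shuffleWord (u ++ [a]) (v ++ [b]) =
      shuffleWord u (v ++ [b]) * letter a + shuffleWord (u ++ [a]) v * letter b
  | [], [] => by
    simp only [List.nil_append, shuffleWord_cons_cons, shuffleWord_nil_left,
      shuffleWord_nil_right, letter_eq_wd]
    rw [add_comm]
  | [], d :: v => by
    have ih := shuffleWord_snoc_snoc a b [] v
    simp only [List.nil_append, List.cons_append, shuffleWord_cons_cons, shuffleWord_nil_left]
      at ih ⊢
    rw [ih]
    simp only [wd_cons, wd_snoc]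
    noncomm_ring
  | c :: u, [] => by
    have ih := shuffleWord_snoc_snoc a b u []
    simp only [List.nil_append, List.cons_append, shuffleWord_cons_cons, shuffleWord_nil_right]
      at ih ⊢
    rw [ih]
    simp only [wd_cons, wd_snoc]
    noncomm_ring
  | c :: u, d :: v => by
    have h1 := shuffleWord_snoc_snoc a b u (d :: v)
    have h2 := shuffleWord_snoc_snoc a b (c :: u) v
    simp only [List.cons_append, shuffleWord_cons_cons] at h1 h2 ⊢
    rw [h1, h2]
    noncomm_ring
termination_by u v => u.length + v.length

/-- The shuffle product as a bilinear map. -/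
noncomputable def shuffleLin : NCPoly →ₗ[ℚ] NCPoly →ₗ[ℚ] NCPoly :=
  (Finsupp.linearCombination ℚ fun u : FreeMonoid Letter =>
    (Finsupp.linearCombination ℚ fun v : FreeMonoid Letter =>
      shuffleWord (FreeMonoid.toList u) (FreeMonoid.toList v)) ∘ₗ
    (MonoidAlgebra.coeffLinearEquiv ℚ).toLinearMap) ∘ₗ
  (MonoidAlgebra.coeffLinearEquiv ℚ).toLinearMap

theorem shuffle_eq_shuffleLin (x y : NCPoly) : shuffle x y = shuffleLin x y := by
  simp only [shuffle, shuffleLin, Finsupp.linearCombination_apply, LinearMap.comp_apply,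
    LinearEquiv.coe_coe, MonoidAlgebra.coeffLinearEquiv_apply, Finsupp.sum, LinearMap.sum_apply,
    LinearMap.smul_apply, Finset.smul_sum, smul_smul]

theorem shuffle_wd (u v : List Letter) : shuffle (wd u) (wd v) = shuffleWord u v := by
  simp [shuffle, wd, MonoidAlgebra.of, MonoidAlgebra.coeff_single]

/-- The span of a set of words. -/
noncomputable def wordSpan (S : Set (List Letter)) : Submodule ℚ NCPoly :=
  Submodule.span ℚ (wd '' S)

theorem wd_mem_wordSpan {S : Set (List Letter)} {w : List Letter} (h : w ∈ S) :
    wd w ∈ wordSpan S := Submodule.subset_span ⟨w, h, rfl⟩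

theorem wordSpan_mono {S T : Set (List Letter)} (h : S ⊆ T) : wordSpan S ≤ wordSpan T :=
  Submodule.span_mono (Set.image_mono h)

theorem wordSpan_induction {S : Set (List Letter)} {p : NCPoly → Prop}
    (hw : ∀ w ∈ S, p (wd w)) (h0 : p 0) (hadd : ∀ x y, p x → p y → p (x + y))
    (hsmul : ∀ (c : ℚ) x, p x → p (c • x)) {x : NCPoly} (hx : x ∈ wordSpan S) : p x := by
  refine Submodule.span_induction (p := fun x _ => p x) ?_ h0 (fun x y _ _ => hadd x y)
    (fun c x _ => hsmul c x) hx
  rintro _ ⟨w, hw', rfl⟩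
  exact hw w hw'

theorem mem_wordSpan_univ (x : NCPoly) : x ∈ wordSpan Set.univ := by
  induction x using MonoidAlgebra.induction_linear with
  | zero => exact zero_mem _
  | add f g hf hg => exact add_mem hf hg
  | single a b =>
    have : MonoidAlgebra.single a b = b • wd (FreeMonoid.toList a) := by
      simp [wd]
    rw [this]
    exact Submodule.smul_mem _ _ (wd_mem_wordSpan trivial)

theorem shuffle_mem {S T : Set (List Letter)} {M : Submodule ℚ NCPoly}
    (h : ∀ u ∈ S, ∀ v ∈ T, shuffleWord u v ∈ M) {x y : NCPoly}
    (hx : x ∈ wordSpan S) (hy : y ∈ wordSpan T) : shuffle x y ∈ M := by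
  rw [shuffle_eq_shuffleLin]
  refine wordSpan_induction (p := fun x => shuffleLin x y ∈ M) ?_ (by simp)
    (fun x y hx hy => by simpa using add_mem hx hy)
    (fun c x hx => by simpa using Submodule.smul_mem _ c hx) hx
  intro u hu
  refine wordSpan_induction (p := fun y => shuffleLin (wd u) y ∈ M) ?_ (by simp)
    (fun x y hx hy => by simpa using add_mem hx hy)
    (fun c x hx => by simpa using Submodule.smul_mem _ c hx) hy
  intro v hv
  rw [← shuffle_eq_shuffleLin, shuffle_wd]
  exact h u hu v hv

theorem mul_letter_mem {S T : Set (List Letter)} (a : Letter) (h : ∀ w ∈ S, w ++ [a] ∈ T)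
    {x : NCPoly} (hx : x ∈ wordSpan S) : x * letter a ∈ wordSpan T := by
  refine wordSpan_induction (p := fun x => x * letter a ∈ wordSpan T) ?_ (by simp)
    (fun x y hx hy => by rw [add_mul]; exact add_mem hx hy)
    (fun c x hx => by rw [smul_mul_assoc]; exact Submodule.smul_mem _ c hx) hx
  intro w hw
  rw [← wd_snoc]
  exact wd_mem_wordSpan (h w hw)

theorem letter_mul_mem {S T : Set (List Letter)} (a : Letter) (h : ∀ w ∈ S, a :: w ∈ T)
    {x : NCPoly} (hx : x ∈ wordSpan S) : letter a * x ∈ wordSpan T := by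
  refine wordSpan_induction (p := fun x => letter a * x ∈ wordSpan T) ?_ (by simp)
    (fun x y hx hy => by rw [mul_add]; exact add_mem hx hy)
    (fun c x hx => by rw [mul_smul_comm]; exact Submodule.smul_mem _ c hx) hx
  intro w hw
  rw [← wd_cons]
  exact wd_mem_wordSpan (h w hw)

/-- Properties shared by all words occurring in the shuffle product of two words. -/
def shuffleSet (u v : List Letter) : Set (List Letter) :=
  {w | (∀ x, w.count x = u.count x + v.count x) ∧
    (∀ x ∈ w.head?, x ∈ u.head? ∨ x ∈ v.head?) ∧
    (∀ x ∈ w.getLast?, x ∈ u.getLast? ∨ x ∈ v.getLast?)}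

theorem shuffleWord_mem : ∀ u v : List Letter, shuffleWord u v ∈ wordSpan (shuffleSet u v)
  | [], v => by
    rw [shuffleWord_nil_left]
    exact wd_mem_wordSpan ⟨by simp, by simp, by simp⟩
  | a :: u, [] => by
    rw [shuffleWord_nil_right]
    exact wd_mem_wordSpan ⟨by simp, by simp, by simp⟩
  | a :: u, b :: v => by
    rw [shuffleWord_cons_cons]
    refine add_mem (letter_mul_mem a ?_ (shuffleWord_mem u (b :: v)))
      (letter_mul_mem b ?_ (shuffleWord_mem (a :: u) v))
    · rintro w ⟨h1, h2, h3⟩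
      refine ⟨fun x => ?_, by simp, ?_⟩
      · have := h1 x
        simp only [List.count_cons] at this ⊢
        omega
      · rcases w.eq_nil_or_concat' with rfl | ⟨w', c, rfl⟩
        · have := h1 b
          simp at this
        · intro x hx
          rw [← List.cons_append, List.getLast?_append] at hx
          have := h3 x (by simpa using hx)
          rcases this with h | h
          · left
            cases u with
            | nil => simp at h
            | cons d u => simpa using h
          · exact Or.inr h
    · rintro w ⟨h1, h2, h3⟩
      refine ⟨fun x => ?_, by simp, ?_⟩
      · have := h1 x
        simp only [List.count_cons] at this ⊢
        omega
      · rcases w.eq_nil_or_concat' with rfl | ⟨w', c, rfl⟩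
        · have := h1 a
          simp only [List.count_nil, List.count_cons_self] at this
          omega
        · intro x hx
          rw [← List.cons_append, List.getLast?_append] at hx
          have := h3 x (by simpa using hx)
          rcases this with h | h
          · exact Or.inl h
          · right
            cases v with
            | nil => simp at h
            | cons d u => simpa using h
termination_by u v => u.length + v.length

/-- Words with `a` letters `e₀` and `b` letters `e₁` that are empty or begin with `e₁`. -/
def startWords (a b : ℕ) : Set (List Letter) :=
  {w | w.count e0 = a ∧ w.count e1 = b ∧ ∀ x ∈ w.head?, x = e1}

/-- Words with `a` letters `e₀` and `b` letters `e₁` that are empty or begin with `e₁`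
and end with `e₀`. -/
def admWords (a b : ℕ) : Set (List Letter) :=
  {w | w ∈ startWords a b ∧ ∀ x ∈ w.getLast?, x = e0}

theorem admWords_subset (a b : ℕ) : admWords a b ⊆ startWords a b := fun _ h => h.1

theorem shuffleSet_subset_startWords {a b a' b' : ℕ} {u v : List Letter}
    (hu : u ∈ startWords a b) (hv : v ∈ startWords a' b') :
    shuffleSet u v ⊆ startWords (a + a') (b + b') := by
  rintro w ⟨h1, h2, -⟩
  refine ⟨by rw [h1, hu.1, hv.1], by rw [h1, hu.2.1, hv.2.1], fun x hx => ?_⟩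
  rcases h2 x hx with h | h
  · exact hu.2.2 x h
  · exact hv.2.2 x h

theorem shuffle_mem_startWords {a b a' b' : ℕ} {x y : NCPoly}
    (hx : x ∈ wordSpan (startWords a b)) (hy : y ∈ wordSpan (startWords a' b')) :
    shuffle x y ∈ wordSpan (startWords (a + a') (b + b')) :=
  shuffle_mem (fun u hu v hv => wordSpan_mono (shuffleSet_subset_startWords hu hv)
    (shuffleWord_mem u v)) hx hy

theorem shuffle_mem_admWords {a b a' b' : ℕ} {x y : NCPoly}
    (hx : x ∈ wordSpan (admWords a b)) (hy : y ∈ wordSpan (admWords a' b')) :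
    shuffle x y ∈ wordSpan (admWords (a + a') (b + b')) := by
  refine shuffle_mem (fun u hu v hv => wordSpan_mono ?_ (shuffleWord_mem u v)) hx hy
  intro w hw
  refine ⟨shuffleSet_subset_startWords hu.1 hv.1 hw, fun x hx => ?_⟩
  rcases hw.2.2 x hx with h | h
  · exact hu.2 x h
  · exact hv.2 x h

theorem one_mem_startWords : (1 : NCPoly) ∈ wordSpan (startWords 0 0) := by
  rw [← wd_nil]
  exact wd_mem_wordSpan ⟨by simp, by simp, by simp⟩

theorem shufflePow_mem_startWords (r : ℕ) :
    shufflePow (letter e1) r ∈ wordSpan (startWords 0 r) := by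
  induction r with
  | zero => exact one_mem_startWords
  | succ r ih =>
    have h : letter e1 ∈ wordSpan (startWords 0 1) := by
      rw [letter_eq_wd]
      exact wd_mem_wordSpan ⟨by simp, by simp, by simp⟩
    simpa only [shufflePow, zero_add] using shuffle_mem_startWords ih h

theorem mul_e0_mem_admWords {a b : ℕ} (hb : 0 < b) {x : NCPoly}
    (hx : x ∈ wordSpan (startWords a b)) (j : ℕ) :
    x * letter e0 ^ (1 + j) ∈ wordSpan (admWords (a + (1 + j)) b) := by
  have key : ∀ (a : ℕ) (x : NCPoly), x ∈ wordSpan (startWords a b) →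
      x * letter e0 ∈ wordSpan (admWords (a + 1) b) := by
    intro a x hx
    refine mul_letter_mem e0 ?_ hx
    rintro w ⟨h1, h2, h3⟩
    refine ⟨⟨by simp [h1], by simp [h2], ?_⟩, by simp⟩
    cases w with
    | nil => simp at h2; omega
    | cons c w => simpa using h3
  induction j with
  | zero => simpa using key a x hx
  | succ j ih =>
    rw [← add_assoc 1 j 1, pow_succ, ← mul_assoc, ← add_assoc]
    exact key _ _ (wordSpan_mono (admWords_subset _ _) ih)

end LogTan

namespace LogTan

open Letter

/-! ### The power series of a word -/

/-- The Taylor coefficients at `0` of `A(w; z)`, where `w` is the reverse of the argument. -/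
def wordCoeff : List Letter → ℕ → ℚ
  | [], m => if m = 0 then 1 else 0
  | e0 :: w, m => if m = 0 then wordCoeff w 0 else wordCoeff w m / m
  | e1 :: w, m => 2 / m * ∑ i ∈ Finset.range m with (m + i) % 2 = 1, wordCoeff w i

theorem wordCoeff_zero : ∀ {w : List Letter}, e1 ∈ w → wordCoeff w 0 = 0
  | [], h => by simp at h
  | e0 :: w, h => by
    have : e1 ∈ w := by simpa using h
    simp [wordCoeff, wordCoeff_zero this]
  | e1 :: w, _ => by simp [wordCoeff]

theorem natCast_mul_wordCoeff_e0 {w : List Letter} (hw : e1 ∈ w) (m : ℕ) :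
    (m : ℚ) * wordCoeff (e0 :: w) m = wordCoeff w m := by
  rcases eq_or_ne m 0 with rfl | hm
  · simp [wordCoeff_zero hw]
  · simp only [wordCoeff, hm, if_false]
    field_simp

theorem natCast_mul_wordCoeff_e1 (w : List Letter) (m : ℕ) :
    (m : ℚ) * wordCoeff (e1 :: w) m =
      2 * ∑ i ∈ Finset.range m with (m + i) % 2 = 1, wordCoeff w i := by
  rcases eq_or_ne m 0 with rfl | hm
  · simp
  · simp only [wordCoeff]
    field_simp

/-- The power series of `A(x; z)`, as a linear function of `x`. -/
noncomputable def series : NCPoly →ₗ[ℚ] PowerSeries ℚ :=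
  (Finsupp.linearCombination ℚ fun w : FreeMonoid Letter =>
      PowerSeries.mk (wordCoeff (FreeMonoid.toList w).reverse)) ∘ₗ
    (MonoidAlgebra.coeffLinearEquiv ℚ).toLinearMap

theorem series_wd (w : List Letter) : series (wd w) = PowerSeries.mk (wordCoeff w.reverse) := by
  simp [series, wd, MonoidAlgebra.of, MonoidAlgebra.coeff_single]

theorem evalA_wd (z : ℂ) (w : List Letter) : evalA z (wd w) = multipleA (wordIndex w) z := by
  simp [evalA, wd, MonoidAlgebra.of, MonoidAlgebra.coeff_single]

/-- The Euler operator `X d/dX` on power series. -/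
noncomputable def euler : PowerSeries ℚ →ₗ[ℚ] PowerSeries ℚ where
  toFun f := PowerSeries.mk fun n => (n : ℚ) * PowerSeries.coeff n f
  map_add' f g := by ext n; simp [mul_add]
  map_smul' c f := by ext n; simp [mul_left_comm]

theorem coeff_euler (n : ℕ) (f : PowerSeries ℚ) :
    PowerSeries.coeff n (euler f) = n * PowerSeries.coeff n f := by
  simp [euler]

theorem euler_mul (f g : PowerSeries ℚ) : euler (f * g) = euler f * g + f * euler g := by
  ext n
  simp only [coeff_euler, map_add, PowerSeries.coeff_mul, Finset.mul_sum,
    ← Finset.sum_add_distrib]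
  refine Finset.sum_congr rfl fun p hp => ?_
  rw [← Finset.HasAntidiagonal.mem_antidiagonal.1 hp]
  push_cast
  ring

theorem eq_of_euler_eq {f g : PowerSeries ℚ} (h : euler f = euler g)
    (h0 : PowerSeries.coeff 0 f = PowerSeries.coeff 0 g) : f = g := by
  ext n
  rcases eq_or_ne n 0 with rfl | hn
  · exact h0
  · have := congrArg (PowerSeries.coeff n) h
    rw [coeff_euler, coeff_euler] at this
    exact mul_left_cancel₀ (Nat.cast_ne_zero.2 hn) this

/-- The series `2 X / (1 - X ^ 2)`. -/
def oddSeries : PowerSeries ℚ := PowerSeries.mk fun n => if n % 2 = 1 then 2 else 0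

theorem euler_series_mul_e1 (x : NCPoly) :
    euler (series (x * letter e1)) = oddSeries * series x := by
  refine wordSpan_induction (S := Set.univ)
    (p := fun x => euler (series (x * letter e1)) = oddSeries * series x) ?_ (by simp)
    (fun x y hx hy => by rw [add_mul, map_add, map_add, hx, hy, map_add, mul_add])
    (fun c x hx => by
      rw [smul_mul_assoc, map_smul, map_smul, hx, map_smul, mul_smul_comm])
    (mem_wordSpan_univ x)
  intro w _
  rw [← wd_snoc, series_wd, series_wd]
  ext m
  simp only [coeff_euler, PowerSeries.coeff_mk, List.reverse_append, List.reverse_singleton,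
    List.singleton_append, natCast_mul_wordCoeff_e1]
  rw [mul_comm oddSeries, PowerSeries.coeff_mul]
  simp only [oddSeries, PowerSeries.coeff_mk]
  rw [Finset.Nat.sum_antidiagonal_eq_sum_range_succ
    (fun i j => wordCoeff w.reverse i * if j % 2 = 1 then (2 : ℚ) else 0), Finset.sum_range_succ,
    Finset.sum_filter, Finset.mul_sum]
  simp only [Nat.sub_self, Nat.zero_mod, zero_ne_one, if_false, mul_zero, add_zero]
  refine Finset.sum_congr rfl fun i hi => ?_
  have hi := Finset.mem_range.1 hi
  have : (m + i) % 2 = 1 ↔ (m - i) % 2 = 1 := by omega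
  simp only [this]
  split_ifs <;> ring

theorem e1_mem_of_startWords {a b : ℕ} (hab : 0 < a + b) {w : List Letter}
    (hw : w ∈ startWords a b) : e1 ∈ w := by
  cases w with
  | nil => have h1 := hw.1; have h2 := hw.2.1; simp at h1 h2; omega
  | cons c w => have := hw.2.2 c (by simp); simp [this]

theorem euler_series_mul_e0 {a b : ℕ} (hab : 0 < a + b) {x : NCPoly}
    (hx : x ∈ wordSpan (startWords a b)) : euler (series (x * letter e0)) = series x := by
  refine wordSpan_induction (p := fun x => euler (series (x * letter e0)) = series x) ?_
    (by simp) (fun x y hx hy => by rw [add_mul, map_add, map_add, hx, hy, map_add])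
    (fun c x hx => by rw [smul_mul_assoc, map_smul, map_smul, hx, map_smul]) hx
  intro w hw
  rw [← wd_snoc, series_wd, series_wd]
  ext m
  simp only [coeff_euler, PowerSeries.coeff_mk, List.reverse_append, List.reverse_singleton,
    List.singleton_append]
  exact natCast_mul_wordCoeff_e0 (List.mem_reverse.2 (e1_mem_of_startWords hab hw)) m

theorem coeff_zero_series {a b : ℕ} (hab : 0 < a + b) {x : NCPoly}
    (hx : x ∈ wordSpan (startWords a b)) : PowerSeries.coeff 0 (series x) = 0 := by
  refine wordSpan_induction (p := fun x => PowerSeries.coeff 0 (series x) = 0) ?_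
    (by simp) (fun x y hx hy => by rw [map_add, map_add, hx, hy, add_zero])
    (fun c x hx => by rw [map_smul, map_smul, hx, smul_zero]) hx
  intro w hw
  rw [series_wd, PowerSeries.coeff_mk]
  exact wordCoeff_zero (List.mem_reverse.2 (e1_mem_of_startWords hab hw))

theorem series_one : series 1 = 1 := by
  rw [← wd_nil, series_wd]
  ext n
  simp [wordCoeff, PowerSeries.coeff_one]

/-- Being empty or beginning with `e₁`. -/
def StartsE1 (w : List Letter) : Prop := ∀ x ∈ w.head?, x = e1

theorem StartsE1.mem_startWords {w : List Letter} (h : StartsE1 w) :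
    w ∈ startWords (w.count e0) (w.count e1) := ⟨rfl, rfl, h⟩

theorem StartsE1.of_snoc {w : List Letter} {a : Letter} (h : StartsE1 (w ++ [a])) :
    StartsE1 w ∧ (w = [] → a = e1) := by
  cases w with
  | nil => exact ⟨by simp [StartsE1], fun _ => h a (by simp)⟩
  | cons c w => exact ⟨fun x hx => h x (by simpa using hx), by simp⟩

theorem count_add_count_pos {w : List Letter} (hw : w ≠ []) :
    0 < w.count e0 + w.count e1 := by
  cases w with
  | nil => exact absurd rfl hw
  | cons c w => cases c <;> simp

theorem euler_series_mul_letter {u v : List Letter} (a : Letter) {x : NCPoly}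
    (hu : StartsE1 (u ++ [a])) (hv : StartsE1 v)
    (hx : x ∈ wordSpan (shuffleSet u v)) (hs : series x = series (wd u) * series (wd v)) :
    euler (series (x * letter a)) = euler (series (wd (u ++ [a]))) * series (wd v) := by
  cases a with
  | e1 => rw [euler_series_mul_e1, wd_snoc, euler_series_mul_e1, hs, mul_assoc]
  | e0 =>
    obtain ⟨hu', hne⟩ := hu.of_snoc
    have hne : u ≠ [] := fun h => by cases hne h
    have hpos := count_add_count_pos hne
    rw [wd_snoc, euler_series_mul_e0 hpos (wd_mem_wordSpan hu'.mem_startWords), ← hs]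
    refine euler_series_mul_e0 ?_ (wordSpan_mono
      (shuffleSet_subset_startWords hu'.mem_startWords hv.mem_startWords) hx)
    omega

theorem shuffleSet_comm (u v : List Letter) : shuffleSet u v = shuffleSet v u := by
  ext w
  simp only [shuffleSet, Set.mem_ofPred_eq, add_comm, or_comm]

theorem series_shuffleWord : ∀ u v : List Letter, StartsE1 u → StartsE1 v →
    series (shuffleWord u v) = series (wd u) * series (wd v) := by
  have key : ∀ (n : ℕ) (u v : List Letter), u.length + v.length = n → StartsE1 u → StartsE1 v →
      series (shuffleWord u v) = series (wd u) * series (wd v) := by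
    intro n
    induction n using Nat.strong_induction_on with
    | _ n ih =>
      intro u v hn hu hv
      rcases u.eq_nil_or_concat' with rfl | ⟨u, a, rfl⟩
      · rw [shuffleWord_nil_left, wd_nil, series_one, one_mul]
      rcases v.eq_nil_or_concat' with rfl | ⟨v, b, rfl⟩
      · rw [shuffleWord_nil_right, wd_nil, series_one, mul_one]
      simp only [List.length_append, List.length_singleton] at hn
      have h1 := ih (u.length + (v.length + 1)) (by omega) u (v ++ [b]) (by simp)
        hu.of_snoc.1 hv
      have h2 := ih (u.length + 1 + v.length) (by omega) (u ++ [a]) v (by simp)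
        hu hv.of_snoc.1
      have hmem := wordSpan_mono (shuffleSet_subset_startWords hu.mem_startWords
        hv.mem_startWords) (shuffleWord_mem (u ++ [a]) (v ++ [b]))
      have hpos : 0 < (u ++ [a]).count e0 + (u ++ [a]).count e1 :=
        count_add_count_pos (by simp)
      refine eq_of_euler_eq ?_ ?_
      · rw [shuffleWord_snoc_snoc, map_add, map_add,
          euler_series_mul_letter a hu hv (shuffleWord_mem u (v ++ [b])) h1,
          euler_series_mul_letter b hv hu (shuffleSet_comm _ _ ▸ shuffleWord_mem (u ++ [a]) v)
            (by rw [h2, mul_comm]), euler_mul, mul_comm (euler (series (wd (v ++ [b]))))]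
      · rw [coeff_zero_series (by omega) hmem, PowerSeries.coeff_mul]
        simp only [Finset.Nat.antidiagonal_zero, Finset.sum_singleton]
        rw [coeff_zero_series hpos (wd_mem_wordSpan hu.mem_startWords), zero_mul]
  exact fun u v => key _ u v rfl

theorem series_shuffle {a b a' b' : ℕ} {x y : NCPoly}
    (hx : x ∈ wordSpan (startWords a b)) (hy : y ∈ wordSpan (startWords a' b')) :
    series (shuffle x y) = series x * series y := by
  rw [shuffle_eq_shuffleLin]
  refine wordSpan_induction (p := fun x => series (shuffleLin x y) = series x * series y) ?_
    (by simp) (fun x x' hx hx' => by simp [hx, hx', add_mul])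
    (fun c x hx => by simp [hx]) hx
  intro u hu
  refine wordSpan_induction
    (p := fun y => series (shuffleLin (wd u) y) = series (wd u) * series y) ?_
    (by simp) (fun x x' hx hx' => by simp [hx, hx', mul_add])
    (fun c x hx => by simp [hx]) hy
  intro v hv
  rw [← shuffle_eq_shuffleLin, shuffle_wd]
  exact series_shuffleWord u v hu.2.2 hv.2.2

end LogTan

namespace LogTan

open Letter

open scoped ENNReal

/-! ### The series defining `A(k; z)`, summed by the last entry -/

/-- The Taylor coefficients at `0` of `A(k; z)`, where `k` is the reverse of the argument. -/
def indexCoeff : List ℕ → ℕ → ℚ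
  | [], m => if m = 0 then 1 else 0
  | a :: k, m => 2 / m ^ a * ∑ i ∈ Finset.range m with (m + i) % 2 = 1, indexCoeff k i

theorem indexCoeff_nonneg : ∀ (k : List ℕ) (m : ℕ), 0 ≤ indexCoeff k m
  | [], m => by rw [indexCoeff]; split_ifs <;> norm_num
  | a :: k, m => by
    rw [indexCoeff]
    have := Finset.sum_nonneg fun i (_ : i ∈ (Finset.range m).filter fun i => (m + i) % 2 = 1) =>
      indexCoeff_nonneg k i
    positivity

theorem wordIndex_snoc_e1 : ∀ w : List Letter, wordIndex (w ++ [e1]) = wordIndex w ++ [1] := by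
  have h : ∀ w : List Letter, leadingE0 (w ++ [e1]) = leadingE0 w := by
    intro w
    induction w with
    | nil => rfl
    | cons a w ih => cases a <;> simp [leadingE0, ih]
  intro w
  induction w with
  | nil => rfl
  | cons a w ih => cases a <;> simp [wordIndex, ih, h]

theorem leadingE0_snoc_e0 (w : List Letter) :
    leadingE0 (w ++ [e0]) = if wordIndex w = [] then leadingE0 w + 1 else leadingE0 w := by
  induction w with
  | nil => rfl
  | cons a w ih =>
    cases a
    · simp only [List.cons_append, leadingE0, ih, wordIndex]
      split_ifs with h <;> simp [h]
    · simp [leadingE0, wordIndex]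

theorem wordIndex_snoc_e0 (w : List Letter) :
    (wordIndex w = [] ∧ wordIndex (w ++ [e0]) = []) ∨
      ∃ k a, 1 ≤ a ∧ wordIndex w = k ++ [a] ∧ wordIndex (w ++ [e0]) = k ++ [a + 1] := by
  induction w with
  | nil => exact Or.inl ⟨rfl, rfl⟩
  | cons c w ih =>
    cases c
    · exact ih
    · right
      rcases ih with ⟨h1, h2⟩ | ⟨k, a, ha, h1, h2⟩
      · exact ⟨[], leadingE0 w + 1, by omega, by simp [wordIndex, h1],
          by simp [wordIndex, h2, leadingE0_snoc_e0, h1]⟩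
      · exact ⟨(leadingE0 w + 1) :: k, a, ha, by simp [wordIndex, h1],
          by simp [wordIndex, h2, leadingE0_snoc_e0, h1]⟩

theorem wordCoeff_reverse (w : List Letter) :
    wordCoeff w.reverse = indexCoeff (wordIndex w).reverse := by
  induction w using List.reverseRecOn with
  | nil => funext m; simp [wordCoeff, indexCoeff, wordIndex]
  | append_singleton w c ih =>
    funext m
    cases c
    · rw [List.reverse_append, List.reverse_singleton, List.singleton_append, wordCoeff, ih]
      rcases wordIndex_snoc_e0 w with ⟨h1, h2⟩ | ⟨k, a, ha, h1, h2⟩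
      · rw [h1, h2]
        simp only [List.reverse_nil, indexCoeff]
        split_ifs <;> simp
      · rw [h1, h2]
        simp only [List.reverse_append, List.reverse_singleton, List.singleton_append, indexCoeff]
        split_ifs with hm
        · subst hm
          simp
        · rw [pow_succ]
          field_simp
    · rw [List.reverse_append, List.reverse_singleton, List.singleton_append, wordCoeff, ih,
        wordIndex_snoc_e1]
      simp [indexCoeff]

theorem lastEntry_lt_iff {n : ℕ} (f : Fin (n + 1) → ℕ) :
    (StrictMono f ∧ ∀ j, 0 < f j ∧ f j ≡ (j : ℕ) + 1 [MOD 2]) ↔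
      (StrictMono (Fin.init f : Fin n → ℕ) ∧
        ∀ j, 0 < Fin.init f j ∧ Fin.init f j ≡ (j : ℕ) + 1 [MOD 2]) ∧
      lastEntry (Fin.init f : Fin n → ℕ) < f (Fin.last n) ∧
      (f (Fin.last n) + lastEntry (Fin.init f : Fin n → ℕ)) % 2 = 1 := by
  have hl : (∀ j, 0 < Fin.init f j ∧ Fin.init f j ≡ (j : ℕ) + 1 [MOD 2]) →
      lastEntry (Fin.init f : Fin n → ℕ) % 2 = n % 2 := by
    intro h
    cases n with
    | zero => simp [lastEntry]
    | succ n => exact (h (Fin.last n)).2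
  constructor
  · rintro ⟨h1, h2⟩
    have h3 : ∀ j : Fin n, 0 < Fin.init f j ∧ Fin.init f j ≡ (j : ℕ) + 1 [MOD 2] :=
      fun j => h2 j.castSucc
    refine ⟨⟨h1.comp Fin.strictMono_castSucc, h3⟩, ?_, ?_⟩
    · cases n with
      | zero => exact (h2 _).1
      | succ n => exact h1 (Fin.castSucc_lt_last _)
    · have h4 := hl h3
      have h5 := (h2 (Fin.last n)).2
      simp only [Nat.ModEq, Fin.val_last] at h5
      omega
  · rintro ⟨⟨h1, h2⟩, h3, h4⟩
    refine ⟨?_, fun j => ?_⟩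
    · rw [Fin.strictMono_iff_lt_succ]
      intro i
      cases n with
      | zero => exact i.elim0
      | succ n =>
        induction i using Fin.lastCases with
        | last => exact h3
        | cast i =>
          rw [Fin.succ_castSucc]
          exact h1 (Fin.castSucc_lt_succ (i := i))
    · induction j using Fin.lastCases with
      | last =>
        refine ⟨by omega, ?_⟩
        have := hl h2
        simp only [Nat.ModEq, Fin.val_last]
        omega
      | cast j => exact h2 j

/-- A parity tuple of depth `n + 1` is one of depth `n` together with a further entry. -/
def parityTupleSucc (n : ℕ) : ParityTuple (n + 1) ≃
    ({p | lastEntry p.2.1 < p.1 ∧ (p.1 + lastEntry p.2.1) % 2 = 1} :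
      Set (ℕ × ParityTuple n)) where
  toFun t := ⟨(t.1 (Fin.last n), ⟨Fin.init t.1, ((lastEntry_lt_iff t.1).1 t.2).1⟩),
    ((lastEntry_lt_iff t.1).1 t.2).2⟩
  invFun p := ⟨Fin.snoc (α := fun _ => ℕ) p.1.2.1 p.1.1, (lastEntry_lt_iff _).2 (by
    simp only [Fin.init_snoc, Fin.snoc_last]
    exact ⟨p.1.2.2, p.2⟩)⟩
  left_inv t := Subtype.ext (Fin.snoc_init_self _)
  right_inv p := by
    apply Subtype.ext
    apply Prod.ext
    · exact Fin.snoc_last (α := fun _ => ℕ) _ _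
    · exact Subtype.ext (Fin.init_snoc (α := fun _ => ℕ) _ _)

/-- The summand `1 / ∏ m_j ^ k_j` as an extended nonnegative real. -/
noncomputable def tupleWeight {n : ℕ} (k m : Fin n → ℕ) : ℝ≥0∞ :=
  ∏ j, ((m j : ℝ≥0∞) ^ k j)⁻¹

theorem ofReal_indexCoeff_cons (a : ℕ) (k : List ℕ) (m : ℕ) :
    ENNReal.ofReal ((indexCoeff (a :: k) m : ℚ) : ℝ) =
      2 * ((m : ℝ≥0∞) ^ a)⁻¹ * ∑ i ∈ Finset.range m with (m + i) % 2 = 1,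
        ENNReal.ofReal ((indexCoeff k i : ℚ) : ℝ) := by
  rcases eq_or_ne m 0 with rfl | hm
  · simp [indexCoeff]
  · have hm' : (0 : ℝ) < m := by positivity
    rw [indexCoeff]
    push_cast
    rw [ENNReal.ofReal_mul (by positivity), ENNReal.ofReal_sum_of_nonneg
      (fun i _ => by exact_mod_cast indexCoeff_nonneg k i), div_eq_mul_inv,
      ENNReal.ofReal_mul (by norm_num), ENNReal.ofReal_inv_of_pos (by positivity),
      ENNReal.ofReal_pow (by positivity)]
    simp

theorem tsum_tupleWeight : ∀ (n : ℕ) (k : Fin n → ℕ) (g : ℕ → ℝ≥0∞),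
    ∑' t : ParityTuple n, g (lastEntry t.1) * (2 ^ n * tupleWeight k t.1) =
      ∑' m, g m * ENNReal.ofReal ((indexCoeff (List.ofFn k).reverse m : ℚ) : ℝ)
  | 0, k, g => by
    have : Unique (ParityTuple 0) :=
      { default := ⟨Fin.elim0, fun i => i.elim0, fun i => i.elim0⟩
        uniq := fun t => Subtype.ext (funext fun i => i.elim0) }
    rw [tsum_fintype, tsum_eq_single 0]
    · simp [tupleWeight, lastEntry, indexCoeff]
    · intro m hm
      simp [indexCoeff, hm]
  | n + 1, k, g => by
    have ih := tsum_tupleWeight n (Fin.init k)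
    have hrev : (List.ofFn k).reverse = k (Fin.last n) :: (List.ofFn (Fin.init k)).reverse := by
      rw [List.ofFn_succ']
      simp
      rfl
    have hW : ∀ t : ParityTuple (n + 1), tupleWeight k t.1 =
        tupleWeight (Fin.init k) (Fin.init t.1 : Fin n → ℕ) *
          ((t.1 (Fin.last n) : ℝ≥0∞) ^ k (Fin.last n))⁻¹ := fun t => by
      simp only [tupleWeight, Fin.prod_univ_castSucc, Fin.init]
    let F : ℕ × ParityTuple n → ℝ≥0∞ := fun p => g p.1 *
      (2 * ((p.1 : ℝ≥0∞) ^ k (Fin.last n))⁻¹ * (2 ^ n * tupleWeight (Fin.init k) p.2.1))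
    have h1 : ∑' t : ParityTuple (n + 1), g (lastEntry t.1) * (2 ^ (n + 1) * tupleWeight k t.1) =
        ∑' p : ({p | lastEntry p.2.1 < p.1 ∧ (p.1 + lastEntry p.2.1) % 2 = 1} :
          Set (ℕ × ParityTuple n)), F p := by
      rw [← (parityTupleSucc n).tsum_eq]
      refine tsum_congr fun t => ?_
      rw [hW t]
      change g (t.1 (Fin.last n)) * _ = g (t.1 (Fin.last n)) *
        (2 * ((t.1 (Fin.last n) : ℝ≥0∞) ^ k (Fin.last n))⁻¹ *
          (2 ^ n * tupleWeight (Fin.init k) (Fin.init t.1)))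
      ring
    rw [h1, tsum_subtype, ENNReal.tsum_prod']
    refine tsum_congr fun m => ?_
    rw [hrev, ofReal_indexCoeff_cons]
    have h2 := ih fun i => if i < m ∧ (m + i) % 2 = 1 then 1 else 0
    have h3 : ∑ i ∈ Finset.range m with (m + i) % 2 = 1,
        ENNReal.ofReal ((indexCoeff (List.ofFn (Fin.init k)).reverse i : ℚ) : ℝ) =
        ∑' i, (if i < m ∧ (m + i) % 2 = 1 then 1 else 0) *
          ENNReal.ofReal ((indexCoeff (List.ofFn (Fin.init k)).reverse i : ℚ) : ℝ) := by
      rw [tsum_eq_sum (s := Finset.range m)]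
      · rw [Finset.sum_filter]
        refine Finset.sum_congr rfl fun i hi => ?_
        simp [Finset.mem_range.1 hi]
      · intro i hi
        simp [Finset.mem_range.not.1 hi]
    rw [h3, ← h2, ← mul_assoc, ← ENNReal.tsum_mul_left]
    refine tsum_congr fun t => ?_
    simp only [Set.indicator, F, Set.mem_ofPred_eq]
    split_ifs <;> ring

theorem hasSum_parityTuple {n : ℕ} (k : Fin n → ℕ) (z : ℂ)
    (h : Summable fun m => ‖z‖ ^ m * ((indexCoeff (List.ofFn k).reverse m : ℚ) : ℝ)) :
    HasSum (fun m => ((indexCoeff (List.ofFn k).reverse m : ℚ) : ℂ) * z ^ m)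
      (2 ^ n * ∑' m : ParityTuple n, z ^ lastEntry m.1 / ∏ j, (m.1 j : ℂ) ^ k j) := by
  set c : ℕ → ℚ := indexCoeff (List.ofFn k).reverse with hc
  have hc0 : ∀ m, (0 : ℝ) ≤ c m := fun m => by exact_mod_cast indexCoeff_nonneg _ m
  set W : ParityTuple n → ℝ≥0∞ := fun t => 2 ^ n * tupleWeight k t.1 with hW
  have hWtop : ∀ t, W t ≠ ⊤ := fun t => by
    refine ENNReal.mul_ne_top (by simp) (ENNReal.prod_ne_top fun j _ => ?_)
    have := (t.2.2 j).1
    exact ENNReal.inv_ne_top.2 (pow_ne_zero _ (by exact_mod_cast this.ne'))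
  have hWr : ∀ t, 2 ^ n * (z ^ lastEntry t.1 / ∏ j, (t.1 j : ℂ) ^ k j) =
      z ^ lastEntry t.1 * (((W t).toReal : ℝ) : ℂ) := fun t => by
    simp only [hW, tupleWeight, ENNReal.toReal_mul, ENNReal.toReal_prod, ENNReal.toReal_inv,
      ENNReal.toReal_pow, ENNReal.toReal_natCast, ENNReal.toReal_ofNat]
    push_cast
    rw [Finset.prod_inv_distrib]
    ring
  have henorm : ∀ t, ‖z ^ lastEntry t.1 * (((W t).toReal : ℝ) : ℂ)‖ₑ =
      ENNReal.ofReal (‖z‖ ^ lastEntry t.1) * W t := fun t => by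
    rw [enorm_mul, ← ofReal_norm, ← ofReal_norm, norm_pow, Complex.norm_real,
      Real.norm_of_nonneg ENNReal.toReal_nonneg, ENNReal.ofReal_toReal (hWtop t)]
  have hsum : Summable fun t : ParityTuple n => z ^ lastEntry t.1 * (((W t).toReal : ℝ) : ℂ) := by
    refine Summable.of_enorm ?_
    simp only [henorm]
    rw [tsum_tupleWeight n k (fun m => ENNReal.ofReal (‖z‖ ^ m))]
    simp only [← ENNReal.ofReal_mul (pow_nonneg (norm_nonneg z) _)]
    rw [← ENNReal.ofReal_tsum_of_nonneg (fun m => mul_nonneg (by positivity) (hc0 m)) h]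
    exact ENNReal.ofReal_ne_top
  rw [← tsum_mul_left, tsum_congr hWr]
  have h1 := hsum.hasSum.tsum_fiberwise fun t : ParityTuple n => lastEntry t.1
  convert! h1 using 2 with m
  have h2 : ∀ t : (fun t : ParityTuple n => lastEntry t.1) ⁻¹' {m},
      z ^ lastEntry t.1.1 * (((W t.1).toReal : ℝ) : ℂ) = z ^ m * (((W t.1).toReal : ℝ) : ℂ) :=
    fun t => by rw [show lastEntry t.1.1 = m from t.2]
  have h3 : (∑' t : (fun t : ParityTuple n => lastEntry t.1) ⁻¹' {m}, (W t.1).toReal) = c m := by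
    rw [← ENNReal.tsum_toReal_eq
      (f := fun t : (fun t : ParityTuple n => lastEntry t.1) ⁻¹' {m} => W t.1)
      fun t => hWtop t.1, tsum_subtype _ W]
    have h4 := tsum_tupleWeight n k fun i => if i = m then 1 else 0
    rw [tsum_eq_single m (fun i hi => by simp [hi])] at h4
    rw [← ENNReal.toReal_ofReal (hc0 m)]
    congr 1
    simp only [if_true, one_mul] at h4
    rw [← h4]
    refine tsum_congr fun t => ?_
    simp [Set.indicator, W]
  rw [tsum_congr h2, tsum_mul_left, ← Complex.ofReal_tsum, h3, mul_comm]
  simp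

theorem hasSum_multipleA (k : List ℕ) (z : ℂ)
    (h : Summable fun m => ‖z‖ ^ m * ((indexCoeff k.reverse m : ℚ) : ℝ)) :
    HasSum (fun m => ((indexCoeff k.reverse m : ℚ) : ℂ) * z ^ m) (multipleA k z) := by
  have := hasSum_parityTuple k.get z (by rwa [List.ofFn_get])
  rwa [List.ofFn_get] at this

theorem multipleA_one (k : List ℕ) : multipleA k 1 = multipleT k := by
  simp only [multipleA, multipleT, one_pow]
  push_cast
  rfl

/-! ### Bounds on the coefficients -/

theorem wordCoeff_nonneg (w : List Letter) (m : ℕ) : 0 ≤ wordCoeff w m := by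
  have := indexCoeff_nonneg (wordIndex w.reverse).reverse m
  rwa [← wordCoeff_reverse, List.reverse_reverse] at this

theorem sum_range_inv_sqrt_le (n : ℕ) :
    ∑ i ∈ Finset.range (n + 1), (if i = 0 then 1 else 1 / √(i : ℝ)) ≤ 1 + 2 * √n := by
  induction n with
  | zero => simp
  | succ n ih =>
    rw [Finset.sum_range_succ, if_neg (by omega)]
    have h1 : (0 : ℝ) < √((n + 1 : ℕ) : ℝ) := Real.sqrt_pos.2 (by positivity)
    have h2 : √(n : ℝ) ≤ √((n + 1 : ℕ) : ℝ) := Real.sqrt_le_sqrt (by push_cast; linarith)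
    have h3 : √((n + 1 : ℕ) : ℝ) ^ 2 = n + 1 := by rw [Real.sq_sqrt (by positivity)]; push_cast; rfl
    have h4 : √(n : ℝ) ^ 2 = n := Real.sq_sqrt (by positivity)
    have h5 : 1 / √((n + 1 : ℕ) : ℝ) ≤ 2 * (√((n + 1 : ℕ) : ℝ) - √(n : ℝ)) := by
      rw [div_le_iff₀ h1]
      nlinarith [sq_nonneg (√((n + 1 : ℕ) : ℝ) - √(n : ℝ))]
    linarith

theorem wordCoeff_le : ∀ (w : List Letter) (m : ℕ),
    ((wordCoeff w m : ℚ) : ℝ) ≤ 6 ^ w.length * if m = 0 then 1 else 1 / √(m : ℝ)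
  | [], m => by
    rw [wordCoeff]
    split_ifs <;> simp
  | e0 :: w, m => by
    have ih := wordCoeff_le w m
    have h0 : (0 : ℝ) ≤ wordCoeff w m := by exact_mod_cast wordCoeff_nonneg w m
    have h1 : ((wordCoeff (e0 :: w) m : ℚ) : ℝ) ≤ wordCoeff w m := by
      rw [wordCoeff]
      split_ifs with hm
      · rw [hm]
      · push_cast
        exact div_le_self h0 (by exact_mod_cast Nat.one_le_iff_ne_zero.2 hm)
    refine h1.trans (ih.trans (mul_le_mul_of_nonneg_right ?_ ?_))
    · exact pow_le_pow_right₀ (by norm_num) (by simp)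
    · split_ifs <;> positivity
  | e1 :: w, m => by
    rcases m with _ | n
    · rw [wordCoeff]
      simp
    have hn : (0 : ℝ) < ((n + 1 : ℕ) : ℝ) := by positivity
    have hs : (0 : ℝ) < √((n + 1 : ℕ) : ℝ) := Real.sqrt_pos.2 hn
    have hss : √((n + 1 : ℕ) : ℝ) * √((n + 1 : ℕ) : ℝ) = ((n + 1 : ℕ) : ℝ) :=
      Real.mul_self_sqrt hn.le
    have h1 : ∑ i ∈ Finset.range (n + 1) with (n + 1 + i) % 2 = 1, ((wordCoeff w i : ℚ) : ℝ) ≤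
        6 ^ w.length * (3 * √((n + 1 : ℕ) : ℝ)) := by
      calc ∑ i ∈ Finset.range (n + 1) with (n + 1 + i) % 2 = 1, ((wordCoeff w i : ℚ) : ℝ)
          ≤ ∑ i ∈ Finset.range (n + 1), ((wordCoeff w i : ℚ) : ℝ) :=
            Finset.sum_le_sum_of_subset_of_nonneg (Finset.filter_subset _ _)
              fun i _ _ => by exact_mod_cast wordCoeff_nonneg w i
        _ ≤ ∑ i ∈ Finset.range (n + 1), 6 ^ w.length * (if i = 0 then 1 else 1 / √(i : ℝ)) :=
            Finset.sum_le_sum fun i _ => wordCoeff_le w i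
        _ ≤ 6 ^ w.length * (1 + 2 * √n) := by
            rw [← Finset.mul_sum]
            exact mul_le_mul_of_nonneg_left (sum_range_inv_sqrt_le n) (by positivity)
        _ ≤ 6 ^ w.length * (3 * √((n + 1 : ℕ) : ℝ)) := by
            refine mul_le_mul_of_nonneg_left ?_ (by positivity)
            have h2 : √(n : ℝ) ≤ √((n + 1 : ℕ) : ℝ) := Real.sqrt_le_sqrt (by push_cast; linarith)
            have h3 : 1 ≤ √((n + 1 : ℕ) : ℝ) := Real.one_le_sqrt.2 (by push_cast; linarith)
            linarith
    rw [wordCoeff, if_neg (by omega), List.length_cons, pow_succ]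
    push_cast at h1 hss hs hn ⊢
    calc 2 / ((n : ℝ) + 1) * ∑ i ∈ Finset.range (n + 1) with (n + 1 + i) % 2 = 1,
          ((wordCoeff w i : ℚ) : ℝ) ≤ 2 / ((n : ℝ) + 1) * (6 ^ w.length * (3 * √((n : ℝ) + 1))) :=
          mul_le_mul_of_nonneg_left h1 (by positivity)
      _ = 6 ^ w.length * 6 * (1 / √((n : ℝ) + 1)) := by
          have : √((n : ℝ) + 1) ^ 2 = n + 1 := by rw [sq, hss]
          field_simp
          rw [this]
          ring

theorem wordCoeff_le_const (w : List Letter) (m : ℕ) :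
    ((wordCoeff w m : ℚ) : ℝ) ≤ 6 ^ w.length := by
  refine (wordCoeff_le w m).trans (mul_le_of_le_one_right (by positivity) ?_)
  split_ifs with hm
  · exact le_rfl
  · rw [div_le_one (Real.sqrt_pos.2 (by positivity))]
    exact Real.one_le_sqrt.2 (by exact_mod_cast Nat.one_le_iff_ne_zero.2 hm)

/-- The coefficients of an admissible word are summable. -/
theorem summable_wordCoeff {w : List Letter} (hw : ∀ x ∈ w.head?, x = e0) :
    Summable fun m => ((wordCoeff w m : ℚ) : ℝ) := by
  rcases w with _ | ⟨c, w⟩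
  · refine summable_of_ne_finset_zero (s := {0}) fun m hm => ?_
    rw [Finset.mem_singleton] at hm
    simp [wordCoeff, hm]
  · obtain rfl : c = e0 := hw c (by simp)
    have h1 : Summable fun m : ℕ => (6 : ℝ) ^ w.length * (1 / (m : ℝ) ^ (3 / 2 : ℝ)) :=
      (Real.summable_one_div_nat_rpow.2 (by norm_num)).mul_left _
    refine (summable_nat_add_iff 1).1 (Summable.of_nonneg_of_le
      (fun m => by exact_mod_cast wordCoeff_nonneg _ _) (fun m => ?_)
      ((summable_nat_add_iff 1).2 h1))
    have h2 := wordCoeff_le w (m + 1)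
    rw [if_neg (by omega)] at h2
    rw [wordCoeff, if_neg (by omega)]
    have hm : (0 : ℝ) < ((m + 1 : ℕ) : ℝ) := by positivity
    have h3 : ((m + 1 : ℕ) : ℝ) ^ (3 / 2 : ℝ) = √((m + 1 : ℕ) : ℝ) * ((m + 1 : ℕ) : ℝ) := by
      rw [Real.sqrt_eq_rpow, ← Real.rpow_add_one hm.ne']
      norm_num
    rw [h3, Rat.cast_div, Rat.cast_natCast, ← div_div, ← mul_div_assoc]
    exact div_le_div_of_nonneg_right h2 hm.le

end LogTan

namespace LogTan

open Letter

/-! ### Analytic properties of `A(x; z)` -/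

theorem hasSum_evalA_of_forall {S : Set (List Letter)} {z : ℂ}
    (hS : ∀ w ∈ S, Summable fun m => ‖z‖ ^ m * ((wordCoeff w.reverse m : ℚ) : ℝ))
    {x : NCPoly} (hx : x ∈ wordSpan S) :
    HasSum (fun m => ((PowerSeries.coeff m (series x) : ℚ) : ℂ) * z ^ m) (evalA z x) := by
  refine wordSpan_induction
    (p := fun x => HasSum (fun m => ((PowerSeries.coeff m (series x) : ℚ) : ℂ) * z ^ m)
      (evalA z x)) ?_ (by simp) ?_ ?_ hx
  · intro w hw
    have := hS w hw
    rw [wordCoeff_reverse] at this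
    simpa [series_wd, evalA_wd, wordCoeff_reverse] using hasSum_multipleA _ z this
  · intro x y hx hy
    rw [map_add]
    simpa [add_mul] using hx.add hy
  · intro c x hx
    rw [map_smul, map_smul, Rat.smul_def]
    simpa [mul_assoc] using hx.mul_left (c : ℂ)

theorem hasSum_evalA {z : ℂ} (hz : ‖z‖ < 1) (x : NCPoly) :
    HasSum (fun m => ((PowerSeries.coeff m (series x) : ℚ) : ℂ) * z ^ m) (evalA z x) := by
  refine hasSum_evalA_of_forall (fun w _ => ?_) (mem_wordSpan_univ x)
  refine Summable.of_nonneg_of_le (fun m => mul_nonneg (by positivity)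
    (by exact_mod_cast wordCoeff_nonneg _ m)) (fun m => mul_le_mul_of_nonneg_left
    (wordCoeff_le_const _ m) (by positivity)) ?_
  exact (summable_geometric_of_lt_one (norm_nonneg z) hz).mul_right _

theorem hasSum_evalA_adm {z : ℂ} (hz : ‖z‖ ≤ 1) {a b : ℕ} {x : NCPoly}
    (hx : x ∈ wordSpan (admWords a b)) :
    HasSum (fun m => ((PowerSeries.coeff m (series x) : ℚ) : ℂ) * z ^ m) (evalA z x) := by
  refine hasSum_evalA_of_forall (fun w hw => ?_) hx
  have h := summable_wordCoeff (w := w.reverse) (by simpa using hw.2)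
  exact Summable.of_nonneg_of_le (fun m => mul_nonneg (by positivity)
    (by exact_mod_cast wordCoeff_nonneg _ m)) (fun m => mul_le_of_le_one_left
    (by exact_mod_cast wordCoeff_nonneg _ m) (pow_le_one₀ (norm_nonneg z) hz)) h

theorem evalA_shuffle_of_hasSum {a b a' b' : ℕ} {x y : NCPoly} {z : ℂ}
    (hx : x ∈ wordSpan (startWords a b)) (hy : y ∈ wordSpan (startWords a' b'))
    (h1 : HasSum (fun m => ((PowerSeries.coeff m (series x) : ℚ) : ℂ) * z ^ m) (evalA z x))
    (h2 : HasSum (fun m => ((PowerSeries.coeff m (series y) : ℚ) : ℂ) * z ^ m) (evalA z y))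
    (h3 : HasSum (fun m => ((PowerSeries.coeff m (series (shuffle x y)) : ℚ) : ℂ) * z ^ m)
      (evalA z (shuffle x y))) :
    evalA z (shuffle x y) = evalA z x * evalA z y := by
  rw [← h1.tsum_eq, ← h2.tsum_eq, ← h3.tsum_eq,
    tsum_mul_tsum_eq_tsum_sum_antidiagonal_of_summable_norm h1.summable.norm h2.summable.norm]
  refine tsum_congr fun m => ?_
  rw [series_shuffle hx hy, PowerSeries.coeff_mul]
  push_cast
  rw [Finset.sum_mul]
  refine Finset.sum_congr rfl fun p hp => ?_
  rw [← Finset.HasAntidiagonal.mem_antidiagonal.1 hp, pow_add]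
  ring

theorem evalA_shuffle {a b a' b' : ℕ} {x y : NCPoly} {z : ℂ} (hz : ‖z‖ < 1)
    (hx : x ∈ wordSpan (startWords a b)) (hy : y ∈ wordSpan (startWords a' b')) :
    evalA z (shuffle x y) = evalA z x * evalA z y :=
  evalA_shuffle_of_hasSum hx hy (hasSum_evalA hz _) (hasSum_evalA hz _) (hasSum_evalA hz _)

theorem evalA_shuffle_adm {a b a' b' : ℕ} {x y : NCPoly} {z : ℂ} (hz : ‖z‖ ≤ 1)
    (hx : x ∈ wordSpan (admWords a b)) (hy : y ∈ wordSpan (admWords a' b')) :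
    evalA z (shuffle x y) = evalA z x * evalA z y :=
  evalA_shuffle_of_hasSum (wordSpan_mono (admWords_subset _ _) hx)
    (wordSpan_mono (admWords_subset _ _) hy) (hasSum_evalA_adm hz hx) (hasSum_evalA_adm hz hy)
    (hasSum_evalA_adm hz (shuffle_mem_admWords hx hy))

theorem evalA_one (z : ℂ) : evalA z 1 = 1 := by
  have : Unique (ParityTuple 0) :=
    { default := ⟨Fin.elim0, fun i => i.elim0, fun i => i.elim0⟩
      uniq := fun t => Subtype.ext (funext fun i => i.elim0) }
  rw [← wd_nil, evalA_wd]
  simp only [wordIndex, multipleA, List.length_nil, pow_zero, one_mul]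
  refine (tsum_fintype _).trans ?_
  rw [Fintype.sum_unique, Finset.prod_eq_one fun j _ => j.elim0]
  simp [lastEntry]

theorem evalA_shufflePow {z : ℂ} (hz : ‖z‖ < 1) (r : ℕ) :
    evalA z (shufflePow (letter e1) r) = evalA z (letter e1) ^ r := by
  induction r with
  | zero => simp [shufflePow, evalA_one]
  | succ r ih =>
    have h := shufflePow_mem_startWords 1
    rw [shufflePow, shufflePow, shuffle_eq_shuffleLin, ← wd_nil, letter_eq_wd,
      ← shuffle_eq_shuffleLin, shuffle_wd, shuffleWord_nil_left, ← letter_eq_wd] at h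
    rw [shufflePow, evalA_shuffle hz (shufflePow_mem_startWords r) h, ih, pow_succ]

theorem norm_mul_exp_I_mul {ρ : ℝ} (hρ : 0 ≤ ρ) (σ : ℝ) :
    ‖(ρ : ℂ) * Complex.exp (Complex.I * σ)‖ = ρ := by
  rw [norm_mul, mul_comm Complex.I, Complex.norm_exp_ofReal_mul_I, mul_one, Complex.norm_real,
    Real.norm_of_nonneg hρ]

theorem coeff_series_mul_e0 {a b : ℕ} (hab : 0 < a + b) {x : NCPoly}
    (hx : x ∈ wordSpan (startWords a b)) (m : ℕ) :
    (m : ℚ) * PowerSeries.coeff m (series (x * letter e0)) = PowerSeries.coeff m (series x) := by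
  rw [← coeff_euler, euler_series_mul_e0 hab hx]

theorem hasDerivAt_evalA {ρ : ℝ} (hρ : 0 ≤ ρ) (hρ' : ρ < 1) {a b : ℕ} (hab : 0 < a + b)
    {x : NCPoly} (hx : x ∈ wordSpan (startWords a b)) (σ : ℝ) :
    HasDerivAt (fun σ : ℝ => evalA (ρ * Complex.exp (Complex.I * σ)) (x * letter e0))
      (Complex.I * evalA (ρ * Complex.exp (Complex.I * σ)) x) σ := by
  have hn : ∀ σ : ℝ, ‖(ρ : ℂ) * Complex.exp (Complex.I * σ)‖ < 1 := fun σ => by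
    rwa [norm_mul_exp_I_mul hρ]
  have h1 : ∀ σ : ℝ, evalA (ρ * Complex.exp (Complex.I * σ)) (x * letter e0) =
      ∑' m, ((PowerSeries.coeff m (series (x * letter e0)) : ℚ) : ℂ) *
        ((ρ : ℂ) * Complex.exp (Complex.I * σ)) ^ m :=
    fun σ => (hasSum_evalA (hn σ) _).tsum_eq.symm
  simp only [h1]
  rw [← (hasSum_evalA (hn σ) x).tsum_eq, ← tsum_mul_left]
  have h0 := (hasSum_evalA (z := (ρ : ℂ)) (by rwa [Complex.norm_real, Real.norm_of_nonneg hρ])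
    x).summable.norm
  refine hasDerivAt_tsum (𝕜 := ℝ) h0
    (g := fun m (σ : ℝ) => ((PowerSeries.coeff m (series (x * letter e0)) : ℚ) : ℂ) *
        ((ρ : ℂ) * Complex.exp (Complex.I * σ)) ^ m)
    (g' := fun m (σ : ℝ) => Complex.I * (((PowerSeries.coeff m (series x) : ℚ) : ℂ) *
        ((ρ : ℂ) * Complex.exp (Complex.I * σ)) ^ m)) (fun m σ => ?_) (fun m σ => ?_)
    (y₀ := 0) (hasSum_evalA (hn 0) _).summable σ
  · have h2 : HasDerivAt (fun σ : ℝ => Complex.exp (Complex.I * σ))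
        (Complex.exp (Complex.I * σ) * (Complex.I * 1)) σ :=
      ((Complex.ofRealCLM.hasDerivAt (x := σ)).const_mul Complex.I).cexp
    have h3 := ((h2.const_mul (ρ : ℂ)).pow m).const_mul
      ((PowerSeries.coeff m (series (x * letter e0)) : ℚ) : ℂ)
    convert! h3 using 1
    have h4 := congrArg (fun q : ℚ => (q : ℂ)) (coeff_series_mul_e0 hab hx m)
    simp only [Rat.cast_mul, Rat.cast_natCast] at h4
    rw [← h4]
    rcases m with _ | m
    · simp
    · rw [Nat.add_sub_cancel, pow_succ]
      ring
  · simp only [norm_mul, norm_pow, Complex.norm_I, one_mul]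
    rw [mul_comm Complex.I, Complex.norm_exp_ofReal_mul_I, mul_one]

theorem continuousOn_evalA {a b : ℕ} {x : NCPoly} (hx : x ∈ wordSpan (admWords a b)) :
    ContinuousOn (fun z => evalA z x) (Metric.closedBall 0 1) := by
  have h0 := (hasSum_evalA_adm (z := 1) (by simp) hx).summable.norm
  have h1 : ContinuousOn (fun z : ℂ => ∑' m, ((PowerSeries.coeff m (series x) : ℚ) : ℂ) * z ^ m)
      (Metric.closedBall 0 1) := by
    refine continuousOn_tsum (fun m => by fun_prop) h0 fun m z hz => ?_
    rw [norm_mul, norm_mul]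
    refine mul_le_mul_of_nonneg_left ?_ (norm_nonneg _)
    rw [norm_pow, one_pow, norm_one]
    exact pow_le_one₀ (norm_nonneg z) (by simpa using hz)
  refine h1.congr fun z hz => ?_
  exact (hasSum_evalA_adm (by simpa using hz) hx).tsum_eq.symm

theorem continuousOn_evalA_polar {a b : ℕ} {x : NCPoly} (hx : x ∈ wordSpan (admWords a b)) :
    ContinuousOn (fun p : ℝ × ℝ => evalA (p.1 * Complex.exp (Complex.I * p.2)) x)
      (Set.Icc 0 1 ×ˢ Set.univ) := by
  refine (continuousOn_evalA hx).comp (by fun_prop) fun p hp => ?_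
  rw [mem_closedBall_zero_iff, norm_mul_exp_I_mul hp.1.1]
  exact hp.1.2

/-! ### The logarithm of the cotangent -/

theorem evalA_letter_e1 {z : ℂ} (hz : ‖z‖ < 1) :
    evalA z (letter e1) = Complex.log (1 + z) - Complex.log (1 - z) := by
  have h1 := (Complex.hasSum_taylorSeries_log hz).add (Complex.hasSum_taylorSeries_neg_log hz)
  rw [sub_eq_add_neg]
  refine (hasSum_evalA hz (letter e1)).unique ?_
  convert! h1 using 2 with m
  rw [letter_eq_wd, series_wd, PowerSeries.coeff_mk, List.reverse_singleton, wordCoeff]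
  have h2 : ∑ i ∈ Finset.range m with (m + i) % 2 = 1, wordCoeff [] i =
      if m % 2 = 1 then 1 else 0 := by
    rw [Finset.sum_filter]
    rcases m with _ | m
    · simp
    · rw [Finset.sum_range_succ']
      simp [wordCoeff]
  rw [h2]
  rcases Nat.mod_two_eq_zero_or_one m with hm | hm
  · rw [(Nat.even_iff.2 hm).add_one.neg_one_pow, hm]
    simp
    ring
  · rw [(Nat.odd_iff.2 hm).add_one.neg_one_pow, hm]
    push_cast
    ring

/-- The boundary value `log (cot (θ / 2)) + π i / 2` of `A(1; z)` at `z = e ^ (i θ)`. -/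
noncomputable def logCot (θ : ℝ) : ℂ :=
  (Real.pi : ℂ) / 2 * Complex.I - (Real.log |Real.tan (θ / 2)| : ℝ)

theorem one_add_exp_eq (θ : ℝ) : 1 + Complex.exp (Complex.I * θ) =
    ((2 * Real.cos (θ / 2) : ℝ) : ℂ) * Complex.exp ((θ / 2 : ℝ) * Complex.I) := by
  have h : Complex.exp (Complex.I * θ) = Complex.exp ((θ / 2 : ℝ) * Complex.I) ^ 2 := by
    rw [← Complex.exp_nat_mul]
    congr 1
    push_cast
    ring
  rw [h, Complex.exp_mul_I]
  push_cast
  have h2 := Complex.sin_sq_add_cos_sq ((θ : ℂ) / 2)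
  linear_combination (-1 : ℂ) * h2 + Complex.sin ((θ : ℂ) / 2) ^ 2 * Complex.I_sq

theorem one_sub_exp_eq (θ : ℝ) : 1 - Complex.exp (Complex.I * θ) =
    ((2 * Real.sin (θ / 2) : ℝ) : ℂ) * Complex.exp (((θ - Real.pi) / 2 : ℝ) * Complex.I) := by
  have h : Complex.exp (Complex.I * θ) = Complex.exp ((θ / 2 : ℝ) * Complex.I) ^ 2 := by
    rw [← Complex.exp_nat_mul]
    congr 1
    push_cast
    ring
  have h3 : Complex.exp (((θ - Real.pi) / 2 : ℝ) * Complex.I) =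
      Complex.exp ((θ / 2 : ℝ) * Complex.I) * (-Complex.I) := by
    rw [← Complex.exp_neg_pi_div_two_mul_I, ← Complex.exp_add]
    congr 1
    push_cast
    ring
  rw [h, h3, Complex.exp_mul_I]
  push_cast
  have h2 := Complex.sin_sq_add_cos_sq ((θ : ℂ) / 2)
  linear_combination (-1 : ℂ) * h2 + Complex.sin ((θ : ℂ) / 2) ^ 2 * Complex.I_sq

theorem log_sub_log_eq_logCot {θ : ℝ} (hθ : θ ∈ Set.Ioo 0 Real.pi) :
    Complex.log (1 + Complex.exp (Complex.I * θ)) -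
      Complex.log (1 - Complex.exp (Complex.I * θ)) = logCot θ := by
  have hs : 0 < Real.sin (θ / 2) :=
    Real.sin_pos_of_pos_of_lt_pi (by linarith [hθ.1]) (by linarith [hθ.1, hθ.2])
  have hc : 0 < Real.cos (θ / 2) :=
    Real.cos_pos_of_mem_Ioo ⟨by linarith [hθ.1, hθ.2], by linarith [hθ.1, hθ.2]⟩
  have hpi := Real.pi_pos
  rw [one_add_exp_eq, one_sub_exp_eq, Complex.log_ofReal_mul (by positivity) (Complex.exp_ne_zero _),
    Complex.log_ofReal_mul (by positivity) (Complex.exp_ne_zero _), Complex.log_exp, Complex.log_exp,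
    logCot, abs_of_pos (by rw [Real.tan_eq_sin_div_cos]; positivity), Real.tan_eq_sin_div_cos,
    Real.log_mul (by norm_num) hc.ne', Real.log_mul (by norm_num) hs.ne',
    Real.log_div hs.ne' hc.ne']
  · push_cast
    ring
  all_goals simp only [Complex.im_ofReal_mul, Complex.I_im]
  all_goals linarith [hθ.1, hθ.2]

end LogTan

namespace LogTan

open Letter Set MeasureTheory Filter Topology

theorem one_add_neg_re_pos {ρ θ : ℝ} (hθ : θ ∈ Ioo 0 Real.pi) (hρ : ρ ∈ Icc (0 : ℝ) 1) :
    0 < (1 + (ρ : ℂ) * Complex.exp (Complex.I * θ)).re ∧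
      0 < (1 - (ρ : ℂ) * Complex.exp (Complex.I * θ)).re := by
  have hs : 0 < Real.sin θ := Real.sin_pos_of_mem_Ioo hθ
  have h1 : |Real.cos θ| < 1 := by
    rw [← sq_lt_one_iff_abs_lt_one]
    nlinarith [Real.sin_sq_add_cos_sq θ]
  rw [abs_lt] at h1
  have h2 : ((ρ : ℂ) * Complex.exp (Complex.I * θ)).re = ρ * Real.cos θ := by
    rw [mul_comm Complex.I, Complex.re_ofReal_mul, Complex.exp_ofReal_mul_I_re]
  rw [Complex.add_re, Complex.sub_re, h2, Complex.one_re]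
  constructor <;> nlinarith [hρ.1, hρ.2, h1.1, h1.2]

theorem tendsto_evalA_e1 {θ : ℝ} (hθ : θ ∈ Ioo 0 Real.pi) :
    Tendsto (fun ρ : ℝ => evalA (ρ * Complex.exp (Complex.I * θ)) (letter e1)) (𝓝[Ico 0 1] 1)
      (𝓝 (logCot θ)) := by
  obtain ⟨h1, h2⟩ := one_add_neg_re_pos hθ (ρ := 1) (by simp)
  rw [Complex.ofReal_one, one_mul] at h1 h2
  have h3 : Tendsto (fun ρ : ℝ => Complex.log (1 + (ρ : ℂ) * Complex.exp (Complex.I * θ)) -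
      Complex.log (1 - (ρ : ℂ) * Complex.exp (Complex.I * θ))) (𝓝[Ico 0 1] 1)
      (𝓝 (Complex.log (1 + ((1 : ℝ) : ℂ) * Complex.exp (Complex.I * θ)) -
        Complex.log (1 - ((1 : ℝ) : ℂ) * Complex.exp (Complex.I * θ)))) := by
    refine Tendsto.mono_left (ContinuousAt.tendsto ?_) nhdsWithin_le_nhds
    refine ContinuousAt.sub (ContinuousAt.clog (by fun_prop) ?_)
      (ContinuousAt.clog (by fun_prop) ?_)
    · rw [Complex.ofReal_one, one_mul]
      exact Or.inl h1
    · rw [Complex.ofReal_one, one_mul]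
      exact Or.inl h2
  rw [Complex.ofReal_one, one_mul, log_sub_log_eq_logCot hθ] at h3
  refine h3.congr' ?_
  filter_upwards [self_mem_nhdsWithin] with ρ hρ
  rw [evalA_letter_e1]
  rw [norm_mul_exp_I_mul hρ.1]
  exact hρ.2

theorem norm_log_le {z : ℂ} {s : ℝ} (hs : 0 < s) (h1 : s ≤ ‖z‖) (h2 : ‖z‖ ≤ 2) :
    ‖Complex.log z‖ ≤ |Real.log s| + (Real.log 2 + Real.pi) := by
  have h3 : |Real.log ‖z‖| ≤ |Real.log s| + Real.log 2 := by
    have h4 := Real.log_le_log hs h1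
    have h5 := Real.log_le_log (hs.trans_le h1) h2
    have h6 : 0 ≤ Real.log 2 := Real.log_nonneg (by norm_num)
    have h7 := neg_abs_le (Real.log s)
    have h8 := abs_nonneg (Real.log s)
    rw [abs_le]
    constructor <;> linarith
  calc ‖Complex.log z‖ ≤ |(Complex.log z).re| + |(Complex.log z).im| :=
        Complex.norm_le_abs_re_add_abs_im _
    _ ≤ |Real.log s| + (Real.log 2 + Real.pi) := by
        rw [Complex.log_re, Complex.log_im]
        linarith [Complex.abs_arg_le_pi z]

theorem norm_evalA_e1_le {ρ θ : ℝ} (hθ : θ ∈ Ioo 0 Real.pi) (hρ : ρ ∈ Ico (0 : ℝ) 1) :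
    ‖evalA (ρ * Complex.exp (Complex.I * θ)) (letter e1)‖ ≤
      2 * (|Real.log (Real.sin θ)| + (Real.log 2 + Real.pi)) := by
  have hs : 0 < Real.sin θ := Real.sin_pos_of_mem_Ioo hθ
  have hn := norm_mul_exp_I_mul hρ.1 θ
  have him : ((ρ : ℂ) * Complex.exp (Complex.I * θ)).im = ρ * Real.sin θ := by
    rw [mul_comm Complex.I, Complex.im_ofReal_mul, Complex.exp_ofReal_mul_I_im]
  have hre : ((ρ : ℂ) * Complex.exp (Complex.I * θ)).re = ρ * Real.cos θ := by
    rw [mul_comm Complex.I, Complex.re_ofReal_mul, Complex.exp_ofReal_mul_I_re]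
  have h1 := norm_log_le (z := 1 + (ρ : ℂ) * Complex.exp (Complex.I * θ)) hs
    (by
      refine Real.le_sqrt_of_sq_le ?_ |>.trans_eq (Complex.norm_def _).symm
      rw [Complex.normSq_apply, Complex.add_re, Complex.add_im, hre, him, Complex.one_re,
        Complex.one_im]
      nlinarith [sq_nonneg (ρ + Real.cos θ), Real.sin_sq_add_cos_sq θ])
    ((norm_add_le _ _).trans (by rw [hn, norm_one]; linarith [hρ.2]))
  have h2 := norm_log_le (z := 1 - (ρ : ℂ) * Complex.exp (Complex.I * θ)) hs
    (by
      refine Real.le_sqrt_of_sq_le ?_ |>.trans_eq (Complex.norm_def _).symm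
      rw [Complex.normSq_apply, Complex.sub_re, Complex.sub_im, hre, him, Complex.one_re,
        Complex.one_im]
      nlinarith [sq_nonneg (ρ - Real.cos θ), Real.sin_sq_add_cos_sq θ])
    ((norm_sub_le _ _).trans (by rw [hn, norm_one]; linarith [hρ.2]))
  rw [evalA_letter_e1 (by rw [hn]; exact hρ.2)]
  exact (norm_sub_le _ _).trans (by linarith)

theorem pow_log_le (c : ℝ) (hc : 0 ≤ c) (r : ℕ) : ∃ K : ℝ, 0 ≤ K ∧ ∀ s : ℝ, 0 < s → s ≤ 1 →
    (2 * (|Real.log s| + c)) ^ r ≤ K * s ^ (-(1 / 2) : ℝ) := by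
  set t : ℝ := 1 / (2 * (r + 1)) with ht
  have ht0 : 0 < t := by positivity
  refine ⟨(2 * (1 / t + c)) ^ r, by positivity, fun s hs hs1 => ?_⟩
  have h1 : |Real.log s| ≤ 1 / t * s ^ (-t) := by
    have := (Real.abs_log_mul_self_rpow_lt s t hs hs1 ht0).le
    rw [abs_mul, abs_of_pos (Real.rpow_pos_of_pos hs t)] at this
    rw [Real.rpow_neg hs.le, ← div_eq_mul_inv, le_div_iff₀ (Real.rpow_pos_of_pos hs t)]
    exact this
  have h2 : 1 ≤ s ^ (-t) := Real.one_le_rpow_of_pos_of_le_one_of_nonpos hs hs1 (by linarith)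
  have h3 : 2 * (|Real.log s| + c) ≤ 2 * (1 / t + c) * s ^ (-t) := by nlinarith
  calc (2 * (|Real.log s| + c)) ^ r ≤ (2 * (1 / t + c) * s ^ (-t)) ^ r :=
        pow_le_pow_left₀ (by positivity) h3 r
    _ = (2 * (1 / t + c)) ^ r * s ^ (-t * r) := by
        rw [mul_pow, Real.rpow_mul_natCast hs.le]
    _ ≤ (2 * (1 / t + c)) ^ r * s ^ (-(1 / 2) : ℝ) := by
        refine mul_le_mul_of_nonneg_left
          (Real.rpow_le_rpow_of_exponent_ge hs hs1 ?_) (by positivity)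
        rw [ht, neg_mul, neg_le_neg_iff, div_mul_eq_mul_div, div_le_div_iff₀ (by positivity)
          (by norm_num)]
        linarith

theorem intervalIntegrable_sin_rpow :
    IntervalIntegrable (fun θ => Real.sin θ ^ (-(1 / 2) : ℝ)) volume 0 Real.pi := by
  have h1 : IntervalIntegrable (fun θ : ℝ => θ ^ (-(1 / 2) : ℝ)) volume 0 Real.pi :=
    intervalIntegral.intervalIntegrable_rpow' (by norm_num)
  have h2 : IntervalIntegrable (fun θ : ℝ => (Real.pi - θ) ^ (-(1 / 2) : ℝ)) volume 0 Real.pi := by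
    have := (h1.comp_sub_left Real.pi).symm
    simpa using this
  have h3 := (h1.add h2).const_mul ((2 / Real.pi) ^ (-(1 / 2) : ℝ))
  refine h3.mono_fun' ?_ ?_
  · exact (Real.continuous_sin.measurable.pow_const _).aestronglyMeasurable
  · rw [uIoc_of_le Real.pi_pos.le, EventuallyLE, ae_restrict_iff' measurableSet_Ioc]
    refine Eventually.of_forall fun θ hθ => ?_
    have hpi := Real.pi_pos
    rw [mul_add, ← Real.mul_rpow (by positivity) hθ.1.le,
      ← Real.mul_rpow (by positivity) (by linarith [hθ.2])]
    have hp1 : 0 ≤ (2 / Real.pi * θ) ^ (-(1 / 2) : ℝ) :=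
      Real.rpow_nonneg (mul_nonneg (by positivity) hθ.1.le) _
    have hp2 : 0 ≤ (2 / Real.pi * (Real.pi - θ)) ^ (-(1 / 2) : ℝ) :=
      Real.rpow_nonneg (mul_nonneg (by positivity) (by linarith [hθ.2])) _
    rw [Real.norm_of_nonneg (Real.rpow_nonneg (Real.sin_nonneg_of_nonneg_of_le_pi hθ.1.le hθ.2) _)]
    rcases hθ.2.eq_or_lt with rfl | hlt
    · rw [Real.sin_pi, Real.zero_rpow (by norm_num)]
      exact add_nonneg hp1 hp2
    rcases le_total θ (Real.pi / 2) with h | h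
    · have h4 := Real.mul_le_sin hθ.1.le h
      have h5 := Real.rpow_le_rpow_of_nonpos (z := -(1 / 2)) (mul_pos (by positivity) hθ.1) h4
        (by norm_num)
      linarith
    · have h4 := Real.mul_le_sin (x := Real.pi - θ) (by linarith) (by linarith)
      rw [Real.sin_pi_sub] at h4
      have h5 := Real.rpow_le_rpow_of_nonpos (z := -(1 / 2))
        (mul_pos (by positivity) (by linarith)) h4 (by norm_num)
      linarith

theorem exists_bound_evalA_e1 (r : ℕ) : ∃ G : ℝ → ℝ, IntervalIntegrable G volume 0 Real.pi ∧
    ∀ θ ∈ Ioo 0 Real.pi, 0 ≤ G θ ∧ ∀ ρ ∈ Ico (0 : ℝ) 1,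
      ‖evalA (ρ * Complex.exp (Complex.I * θ)) (letter e1) ^ r‖ ≤ G θ := by
  obtain ⟨K, hK, h⟩ := pow_log_le (Real.log 2 + Real.pi)
    (add_nonneg (Real.log_nonneg (by norm_num)) Real.pi_pos.le) r
  refine ⟨fun θ => K * Real.sin θ ^ (-(1 / 2) : ℝ), intervalIntegrable_sin_rpow.const_mul K,
    fun θ hθ => ?_⟩
  have hs : 0 < Real.sin θ := Real.sin_pos_of_mem_Ioo hθ
  refine ⟨by positivity, fun ρ hρ => ?_⟩
  rw [norm_pow]
  exact (pow_le_pow_left₀ (norm_nonneg _) (norm_evalA_e1_le hθ hρ) r).trans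
    (h _ hs (Real.sin_le_one θ))

theorem exists_bound_logCot (r : ℕ) : ∃ G : ℝ → ℝ, IntervalIntegrable G volume 0 Real.pi ∧
    ∀ θ ∈ Ioo 0 Real.pi, ‖logCot θ ^ r‖ ≤ G θ := by
  obtain ⟨G, hG, h⟩ := exists_bound_evalA_e1 r
  refine ⟨G, hG, fun θ hθ => ?_⟩
  have hne : (𝓝[Ico (0 : ℝ) 1] 1).NeBot := by
    rw [← mem_closure_iff_nhdsWithin_neBot, closure_Ico (by norm_num)]
    simp
  refine le_of_tendsto ((tendsto_evalA_e1 hθ).pow r).norm ?_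
  filter_upwards [self_mem_nhdsWithin] with ρ hρ
  exact (h θ hθ).2 ρ hρ

theorem measurable_logCot : Measurable logCot := by
  unfold logCot
  have : Measurable Real.tan := by
    have : Real.tan = fun x => Real.sin x / Real.cos x := funext Real.tan_eq_sin_div_cos
    rw [this]
    exact Real.measurable_sin.div Real.measurable_cos
  exact measurable_const.sub (Complex.measurable_ofReal.comp
    (Real.measurable_log.comp (this.comp (by fun_prop)).abs))

theorem ae_mem_Ioo {σ : ℝ} (hσ : σ ∈ Icc 0 Real.pi) :
    ∀ᵐ θ : ℝ, θ ∈ uIoc 0 σ → θ ∈ Ioo 0 Real.pi := by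
  have : ∀ᵐ θ : ℝ, θ ≠ Real.pi := by simp [ae_iff]
  filter_upwards [this] with θ h1 h2
  rw [uIoc_of_le hσ.1] at h2
  exact ⟨h2.1, lt_of_le_of_ne (h2.2.trans hσ.2) h1⟩

theorem intervalIntegrable_mono_Icc {E : Type*} [NormedAddCommGroup E] {f : ℝ → E} {σ : ℝ}
    (h : IntervalIntegrable f volume 0 Real.pi) (hσ : σ ∈ Icc 0 Real.pi) :
    IntervalIntegrable f volume 0 σ :=
  h.mono_set (by rw [uIcc_of_le hσ.1, uIcc_of_le Real.pi_pos.le]; exact Icc_subset_Icc_right hσ.2)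

theorem intervalIntegrable_logCot_mul {φ : ℝ → ℂ} (hφ : ContinuousOn φ (Icc 0 Real.pi)) (r : ℕ)
    {σ : ℝ} (hσ : σ ∈ Icc 0 Real.pi) :
    IntervalIntegrable (fun θ => logCot θ ^ r * φ θ) volume 0 σ := by
  obtain ⟨G, hG, h⟩ := exists_bound_logCot r
  have h1 : IntervalIntegrable (fun θ => logCot θ ^ r) volume 0 Real.pi := by
    refine hG.mono_fun' (measurable_logCot.pow_const r).aestronglyMeasurable ?_
    rw [EventuallyLE, ae_restrict_iff' measurableSet_uIoc]
    filter_upwards [ae_mem_Ioo (right_mem_Icc.2 Real.pi_pos.le)] with θ h1 h2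
    exact h θ (h1 h2)
  exact intervalIntegrable_mono_Icc
    (h1.mul_continuousOn (by rwa [uIcc_of_le Real.pi_pos.le])) hσ

theorem continuous_evalA_e1 {ρ : ℝ} (hρ : ρ ∈ Ico (0 : ℝ) 1) :
    Continuous fun θ : ℝ => evalA (ρ * Complex.exp (Complex.I * θ)) (letter e1) := by
  have hn : ∀ θ : ℝ, ‖(ρ : ℂ) * Complex.exp (Complex.I * θ)‖ < 1 := fun θ => by
    rw [norm_mul_exp_I_mul hρ.1]; exact hρ.2
  have : (fun θ : ℝ => evalA (ρ * Complex.exp (Complex.I * θ)) (letter e1)) = fun θ : ℝ =>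
      Complex.log (1 + ρ * Complex.exp (Complex.I * θ)) -
        Complex.log (1 - ρ * Complex.exp (Complex.I * θ)) :=
    funext fun θ => evalA_letter_e1 (hn θ)
  rw [this]
  have hre : ∀ θ : ℝ, |((ρ : ℂ) * Complex.exp (Complex.I * θ)).re| < 1 :=
    fun θ => (Complex.abs_re_le_norm _).trans_lt (hn θ)
  refine Continuous.sub (Continuous.clog (by fun_prop) fun θ => Or.inl ?_)
    (Continuous.clog (by fun_prop) fun θ => Or.inl ?_)
  · rw [Complex.add_re, Complex.one_re]
    linarith [(abs_lt.1 (hre θ)).1]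
  · rw [Complex.sub_re, Complex.one_re]
    linarith [(abs_lt.1 (hre θ)).2]

theorem tendsto_integral_evalA_e1 {φ : ℝ × ℝ → ℂ} (hφ : ContinuousOn φ (Icc 0 1 ×ˢ univ)) (r : ℕ)
    {σ : ℝ} (hσ : σ ∈ Icc 0 Real.pi) :
    Tendsto (fun ρ : ℝ => ∫ θ in 0..σ,
        evalA (ρ * Complex.exp (Complex.I * θ)) (letter e1) ^ r * φ (ρ, θ)) (𝓝[Ico 0 1] 1)
      (𝓝 (∫ θ in 0..σ, logCot θ ^ r * φ (1, θ))) := by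
  obtain ⟨G, hG, h⟩ := exists_bound_evalA_e1 r
  obtain ⟨C, hC⟩ := (isCompact_Icc.prod isCompact_Icc).exists_bound_of_continuousOn
    (hφ.mono (prod_mono_right (subset_univ (Icc 0 Real.pi))))
  refine intervalIntegral.tendsto_integral_filter_of_dominated_convergence (fun θ => G θ * C)
    ?_ ?_ ((intervalIntegrable_mono_Icc hG hσ).mul_const C) ?_
  · filter_upwards [self_mem_nhdsWithin] with ρ hρ
    have h1 : Continuous fun θ : ℝ => φ (ρ, θ) := by
      rw [← continuousOn_univ]
      exact hφ.comp (by fun_prop) fun θ _ => ⟨Ico_subset_Icc_self hρ, trivial⟩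
    exact (((continuous_evalA_e1 hρ).measurable.pow_const r).mul h1.measurable).aestronglyMeasurable
  · filter_upwards [self_mem_nhdsWithin] with ρ hρ
    filter_upwards [ae_mem_Ioo hσ] with θ h1 h2
    rw [norm_mul]
    exact mul_le_mul ((h θ (h1 h2)).2 ρ hρ)
      (hC (ρ, θ) ⟨Ico_subset_Icc_self hρ, Ioo_subset_Icc_self (h1 h2)⟩) (norm_nonneg _)
      (h θ (h1 h2)).1
  · filter_upwards [ae_mem_Ioo hσ] with θ h1 h2
    refine ((tendsto_evalA_e1 (h1 h2)).pow r).mul ?_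
    have h3 : ContinuousOn (fun ρ : ℝ => φ (ρ, θ)) (Icc 0 1) :=
      hφ.comp (by fun_prop) fun ρ hρ => ⟨hρ, trivial⟩
    exact (h3 1 (by simp)).mono_left (nhdsWithin_mono _ Ico_subset_Icc_self)

end LogTan

namespace LogTan

open Letter Set MeasureTheory Filter Topology

/-! ### Combinatorics of the coefficients -/

theorem take_append_singleton_sum (j : List ℕ) (b u : ℕ) :
    ((j ++ [b]).take u).sum = if u ≤ j.length then (j.take u).sum else j.sum + b := by
  split_ifs with h
  · rw [List.take_append_of_le_length h]
  · rw [List.take_of_length_le (by simp; omega)]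
    simp

theorem Prec.sum_le {j q : List ℕ} (h : Prec j q) : j.sum ≤ q.sum := by
  have := h.2 q.length
  rwa [List.take_length, ← h.1, List.take_length] at this

theorem prec_snoc_iff (j q : List ℕ) (b x : ℕ) :
    Prec (j ++ [b]) (q ++ [x]) ↔ Prec j q ∧ j.sum + b ≤ q.sum + x := by
  constructor
  · rintro ⟨h1, h2⟩
    have hl : j.length = q.length := by simpa using h1
    simp only [take_append_singleton_sum, hl] at h2
    have key : ∀ u, u ≤ q.length → (j.take u).sum ≤ (q.take u).sum := fun u hu => by
      simpa [hu] using h2 u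
    refine ⟨⟨hl, fun u => ?_⟩, by simpa using h2 (q.length + 1)⟩
    rcases le_total u q.length with hu | hu
    · exact key u hu
    · have := key q.length le_rfl
      rw [List.take_of_length_le hu, List.take_of_length_le (hl.trans_le hu)]
      rwa [List.take_length, ← hl, List.take_length] at this
  · rintro ⟨⟨h1, h2⟩, h3⟩
    refine ⟨by simp [h1], fun u => ?_⟩
    simp only [take_append_singleton_sum, h1]
    split_ifs
    · exact h2 u
    · exact h3

theorem sum_precSet_snoc {E : Type*} [AddCommMonoid E] (q : List ℕ) (x : ℕ) (g : List ℕ → E) :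
    ∑ j ∈ precSet (q ++ [x]), g j =
      ∑ j ∈ precSet q, ∑ b ∈ Finset.range (q.sum + x - j.sum + 1), g (j ++ [b]) := by
  rw [Finset.sum_sigma']
  refine (Finset.sum_nbij (fun p : (_ : List ℕ) × ℕ => p.1 ++ [p.2]) ?_ ?_ ?_ ?_).symm
  · rintro ⟨j, b⟩ hp
    rw [Finset.mem_sigma, mem_precSet, Finset.mem_range] at hp
    rw [mem_precSet, prec_snoc_iff]
    have := hp.1.sum_le
    exact ⟨hp.1, by have := hp.2; dsimp only at *; omega⟩
  · rintro ⟨j, b⟩ _ ⟨j', b'⟩ _ h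
    have := List.append_inj' h rfl
    simp only [List.cons.injEq, and_true] at this
    obtain ⟨rfl, rfl⟩ := this
    rfl
  · intro l hl
    rw [Finset.mem_coe, mem_precSet] at hl
    rcases l.eq_nil_or_concat' with rfl | ⟨j, b, rfl⟩
    · have := hl.1
      simp at this
    · rw [prec_snoc_iff] at hl
      refine ⟨⟨j, b⟩, ?_, rfl⟩
      rw [Finset.mem_coe, Finset.mem_sigma, mem_precSet, Finset.mem_range]
      exact ⟨hl.1, by have := hl.2; dsimp only; omega⟩
  · intro _ _
    rfl

theorem coeffC_snoc {q j : List ℕ} (h : j.length = q.length) (x b : ℕ) :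
    coeffC (q ++ [x]) (j ++ [b]) = coeffC q j * ((-1) ^ b *
      (((q.sum + x - j.sum).factorial : ℚ) / ((q.sum + x - j.sum - b).factorial : ℚ))) := by
  simp only [coeffC, List.length_append, List.length_singleton, Finset.prod_range_succ,
    take_append_singleton_sum, h, List.sum_append, List.sum_singleton, pow_add]
  have h1 : j.take q.length = j := by rw [← h, List.take_length]
  have h2 : ∀ u ∈ Finset.range q.length, u + 1 ≤ q.length ∧ u ≤ q.length := fun u hu => by
    have := Finset.mem_range.1 hu
    omega
  rw [Finset.prod_congr rfl (fun u hu => by rw [if_pos (h2 u hu).1, if_pos (h2 u hu).2,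
    if_pos (h2 u hu).1])]
  simp only [h1, le_refl, if_true, Nat.not_succ_le_self, if_false, Nat.sub_sub]
  ring

theorem coeffB_snoc (q : List ℕ) (x : ℕ) :
    coeffB (q ++ [x]) = coeffB q * (1 / ((q.sum + q.length + x + 1 : ℕ) : ℚ)) := by
  simp only [coeffB, List.length_append, List.length_singleton, Finset.prod_range_succ,
    take_append_singleton_sum]
  have h2 : ∀ u ∈ Finset.range q.length, u + 1 ≤ q.length := fun u hu =>
    Finset.mem_range.1 hu
  rw [Finset.prod_congr rfl (fun u hu => by rw [if_pos (h2 u hu)])]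
  simp only [Nat.not_succ_le_self, if_false]
  congr 3
  ring

theorem qBar_snoc (q' n : List ℕ) (a : ℕ) : ∃ x, qBar q' (n ++ [a]) = qBar q' n ++ [x] ∧
    (qBar q' n).sum + x = q'.sum + q'.length + n.sum + a := by
  cases n with
  | nil => exact ⟨q'.sum + q'.length + a, by simp [qBar], by simp [qBar]⟩
  | cons c n => exact ⟨a, by simp [qBar], by simp [qBar]; omega⟩

theorem qBar_sum_le (q' n : List ℕ) : (qBar q' n).sum ≤ q'.sum + q'.length + n.sum := by
  cases n with
  | nil => simp [qBar]
  | cons c n => simp [qBar]; omega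

theorem qBar_length (q' n : List ℕ) : (qBar q' n).length = n.length := by
  cases n <;> simp [qBar]

theorem sum_pos_of_head {r : List ℕ} (hr : r ≠ []) (h : ∀ x ∈ r.head?, 0 < x) : 0 < r.sum := by
  cases r with
  | nil => exact absurd rfl hr
  | cons a r => have := h a (by simp); simp; omega

theorem wordW_snoc {j r : List ℕ} (h : j.length = r.length) (b a : ℕ) :
    wordW (j ++ [b]) (r ++ [a]) =
      shuffle (wordW j r) (shufflePow (letter e1) a) * letter e0 ^ (1 + b) := by
  rw [wordW, List.zip_append h, List.foldl_append]
  rfl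

theorem head?_of_snoc {α : Type*} {p : α → Prop} {r : List α} {a : α}
    (h : ∀ x ∈ (r ++ [a]).head?, p x) : ∀ x ∈ r.head?, p x := by
  cases r with
  | nil => simp
  | cons c r => simpa using h

theorem wordW_mem : ∀ {j r : List ℕ}, j.length = r.length → (∀ x ∈ r.head?, 0 < x) →
    wordW j r ∈ wordSpan (admWords (j.sum + j.length) r.sum) := by
  intro j r
  induction r using List.reverseRecOn generalizing j with
  | nil =>
    intro h _
    obtain rfl := List.length_eq_zero_iff.1 h
    rw [wordW, List.zip_nil_left, List.foldl_nil, ← wd_nil]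
    exact wd_mem_wordSpan ⟨⟨by simp, by simp, by simp⟩, by simp⟩
  | append_singleton r a ih =>
    intro h hr
    rcases j.eq_nil_or_concat' with rfl | ⟨j, b, rfl⟩
    · simp at h
    have hl : j.length = r.length := by simpa using h
    rw [wordW_snoc hl]
    have h1 := ih hl (head?_of_snoc hr)
    have h2 := shuffle_mem_startWords (wordSpan_mono (admWords_subset _ _) h1)
      (shufflePow_mem_startWords a)
    have h3 := sum_pos_of_head (by simp) hr
    rw [List.sum_append, List.sum_singleton] at h3
    have h4 := mul_e0_mem_admWords h3 h2 b
    convert h4 using 3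
    · simp
      omega
    · simp

theorem hasDerivAt_telescope (φ : ℕ → ℝ → ℂ) (σ : ℝ)
    (hφ : ∀ b, HasDerivAt (φ (b + 1)) (Complex.I * φ b σ) σ) (N : ℕ) :
    HasDerivAt (fun σ : ℝ => ∑ b ∈ Finset.range (N + 1),
      ((-1) ^ b * ((N.factorial : ℂ) / ((N - b).factorial : ℂ))) *
        (Complex.I * σ) ^ (N - b) * φ (b + 1) σ) (Complex.I * (Complex.I * σ) ^ N * φ 0 σ) σ := by
  induction N generalizing φ with
  | zero => simpa using hφ 0
  | succ N ih =>
    have h1 := ih (fun b => φ (b + 1)) fun b => hφ (b + 1)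
    have h2 : HasDerivAt (fun σ : ℝ => (Complex.I * σ) ^ (N + 1))
        ((N + 1 : ℕ) * (Complex.I * σ) ^ N * (Complex.I * 1)) σ :=
      ((Complex.ofRealCLM.hasDerivAt (x := σ)).const_mul Complex.I).pow (N + 1)
    have h3 := (h2.mul (hφ 0)).sub (h1.const_mul ((N + 1 : ℕ) : ℂ))
    convert! h3 using 1
    · funext τ
      rw [Finset.sum_range_succ', add_comm]
      simp only [Pi.sub_apply, Pi.mul_apply, Finset.mul_sum]
      rw [sub_eq_add_neg, ← Finset.sum_neg_distrib]
      congr 1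
      · simp [div_self (Nat.cast_ne_zero.2 (Nat.factorial_ne_zero (N + 1)) :
          ((N + 1).factorial : ℂ) ≠ 0)]
      · refine Finset.sum_congr rfl fun b _ => ?_
        rw [Nat.add_sub_add_right, Nat.factorial_succ, pow_succ]
        push_cast
        ring
    · ring

/-! ### The functions `f̃` inside the unit disc -/

/-- The function `f̃` for the splitting `(q', N)`, evaluated on the circle of radius `ρ`. -/
noncomputable def blockFun (ρ : ℝ) (q' : List ℕ) (N : List (ℕ × ℕ)) (σ : ℝ) : ℂ :=
  (coeffB q' : ℂ) * ∑ j ∈ precSet (qBar q' (N.map Prod.fst)),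
    (coeffC (qBar q' (N.map Prod.fst)) j : ℂ) *
      (Complex.I * (σ : ℂ)) ^ (q'.sum + q'.length + (N.map Prod.fst).sum - j.sum) *
      evalA (ρ * Complex.exp (Complex.I * (σ : ℂ))) (wordW j (N.map Prod.snd))

theorem blockFun_nil (ρ : ℝ) (q' : List ℕ) (σ : ℝ) :
    blockFun ρ q' [] σ = coeffB q' * (Complex.I * (σ : ℂ)) ^ (q'.sum + q'.length) := by
  have : precSet [] = {[]} := by simp [precSet, precList]
  simp [blockFun, qBar, this, coeffC, wordW, evalA_one]

theorem hasDerivAt_blockFun_nil (ρ : ℝ) (q' : List ℕ) (a : ℕ) (σ : ℝ) :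
    HasDerivAt (blockFun ρ (q' ++ [a]) [])
      (Complex.I * (Complex.I * σ) ^ a * blockFun ρ q' [] σ) σ := by
  have h0 : blockFun ρ (q' ++ [a]) [] = fun σ : ℝ => ((coeffB (q' ++ [a]) : ℚ) : ℂ) *
      (Complex.I * (σ : ℂ)) ^ (q'.sum + q'.length + a + 1) := by
    funext σ
    rw [blockFun_nil]
    congr 2
    simp
    omega
  rw [h0, blockFun_nil]
  have h2 := (((Complex.ofRealCLM.hasDerivAt (x := σ)).const_mul Complex.I).pow
    (q'.sum + q'.length + a + 1)).const_mul ((coeffB (q' ++ [a]) : ℚ) : ℂ)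
  convert! h2 using 1
  rw [coeffB_snoc, Nat.add_sub_cancel]
  have h3 : ((q'.sum + q'.length + a + 1 : ℕ) : ℂ) ≠ 0 := Nat.cast_ne_zero.2 (by omega)
  rw [Rat.cast_mul, Rat.cast_div, Rat.cast_one, Rat.cast_natCast, Complex.ofRealCLM_apply,
    Complex.ofRealCLM_apply, Complex.ofReal_one]
  generalize ((q'.sum + q'.length + a + 1 : ℕ) : ℂ) = S at h3 ⊢
  field_simp
  ring

theorem hasDerivAt_blockFun {ρ : ℝ} (hρ : ρ ∈ Ico (0 : ℝ) 1) (q' : List ℕ) (N : List (ℕ × ℕ))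
    (a : ℕ × ℕ) (hN : ∀ p ∈ (N ++ [a]).head?, 0 < p.2) (σ : ℝ) :
    HasDerivAt (blockFun ρ q' (N ++ [a]))
      (Complex.I * (Complex.I * σ) ^ a.1 *
        evalA (ρ * Complex.exp (Complex.I * σ)) (letter e1) ^ a.2 * blockFun ρ q' N σ) σ := by
  obtain ⟨x, hx1, hx2⟩ := qBar_snoc q' (N.map Prod.fst) a.1
  set Q := qBar q' (N.map Prod.fst) with hQ
  set E := q'.sum + q'.length + (N.map Prod.fst).sum with hE
  set r := N.map Prod.snd with hr
  have hz : ∀ σ : ℝ, ‖(ρ : ℂ) * Complex.exp (Complex.I * σ)‖ < 1 := fun σ => by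
    rw [norm_mul_exp_I_mul hρ.1]; exact hρ.2
  have hhead : ∀ y ∈ (r ++ [a.2]).head?, 0 < y := by
    cases N with
    | nil => simpa [hr] using hN
    | cons c N => simpa [hr] using hN
  let Y : List ℕ → NCPoly := fun j => shuffle (wordW j r) (shufflePow (letter e1) a.2)
  let φ : List ℕ → ℕ → ℝ → ℂ := fun j b σ =>
    evalA (ρ * Complex.exp (Complex.I * σ)) (Y j * letter e0 ^ b)
  have hlen : ∀ j ∈ precSet Q, j.length = r.length := fun j hj => by
    rw [((mem_precSet _ _).1 hj).1, hQ, qBar_length, hr, List.length_map, List.length_map]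
  have hW : ∀ j ∈ precSet Q, wordW j r ∈ wordSpan (startWords (j.sum + j.length) r.sum) :=
    fun j hj => wordSpan_mono (admWords_subset _ _) (wordW_mem (hlen j hj) (head?_of_snoc hhead))
  have hpos : 0 < r.sum + a.2 := by
    have := sum_pos_of_head (by simp) hhead
    simpa using this
  have hφ : ∀ j ∈ precSet Q, ∀ b, HasDerivAt (φ j (b + 1)) (Complex.I * φ j b σ) σ := by
    intro j hj b
    have h1 := shuffle_mem_startWords (hW j hj) (shufflePow_mem_startWords a.2)
    have h2 : Y j * letter e0 ^ b ∈
        wordSpan (startWords (j.sum + j.length + 0 + b) (r.sum + a.2)) := by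
      cases b with
      | zero => simpa using h1
      | succ b =>
        rw [add_comm b 1]
        exact wordSpan_mono (admWords_subset _ _) (mul_e0_mem_admWords hpos h1 b)
    have h3 := hasDerivAt_evalA hρ.1 hρ.2 (by omega) h2 σ
    simp only [mul_assoc (Y j), ← pow_succ] at h3
    exact h3
  have h1 : blockFun ρ q' (N ++ [a]) = fun σ => (coeffB q' : ℂ) * ∑ j ∈ precSet Q,
      (coeffC Q j : ℂ) * ∑ b ∈ Finset.range (E + a.1 - j.sum + 1),
        ((-1) ^ b * (((E + a.1 - j.sum).factorial : ℂ) /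
          ((E + a.1 - j.sum - b).factorial : ℂ))) *
        (Complex.I * σ) ^ (E + a.1 - j.sum - b) * φ j (b + 1) σ := by
    funext σ
    rw [blockFun]
    simp only [List.map_append, List.map_singleton, hx1, sum_precSet_snoc, hx2, ← hr]
    congr 1
    refine Finset.sum_congr rfl fun j hj => ?_
    rw [Finset.mul_sum]
    refine Finset.sum_congr rfl fun b _ => ?_
    rw [coeffC_snoc ((mem_precSet _ _).1 hj).1, hx2, wordW_snoc (hlen j hj), List.sum_append,
      List.sum_append, List.sum_singleton, List.sum_singleton, add_comm 1 b]
    simp only [φ, Y, Nat.sub_sub, hE, ← add_assoc]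
    push_cast
    ring
  rw [h1]
  have h2 := HasDerivAt.fun_sum (u := precSet Q) fun j hj => (hasDerivAt_telescope (φ j) σ
    (hφ j hj) (E + a.1 - j.sum)).const_mul (coeffC Q j : ℂ)
  refine (h2.const_mul (coeffB q' : ℂ)).congr_deriv ?_
  rw [blockFun, mul_left_comm _ (coeffB q' : ℂ)]
  congr 1
  rw [Finset.mul_sum]
  refine Finset.sum_congr rfl fun j hj => ?_
  have h2 : j.sum ≤ E := ((mem_precSet _ _).1 hj).sum_le.trans (qBar_sum_le _ _)
  simp only [φ, Y, pow_zero, mul_one]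
  rw [evalA_shuffle (hz σ) (hW j hj) (shufflePow_mem_startWords a.2), evalA_shufflePow (hz σ),
    show E + a.1 - j.sum = a.1 + (E - j.sum) by omega, pow_add]
  ring

theorem continuousOn_blockFun (q' : List ℕ) (N : List (ℕ × ℕ)) (hN : ∀ p ∈ N.head?, 0 < p.2) :
    ContinuousOn (fun p : ℝ × ℝ => blockFun p.1 q' N p.2) (Icc 0 1 ×ˢ univ) := by
  unfold blockFun
  refine continuousOn_const.mul (continuousOn_finsetSum _ fun j hj => ?_)
  refine ContinuousOn.mul (by fun_prop) (continuousOn_evalA_polar (wordW_mem ?_ ?_))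
  · rw [((mem_precSet _ _).1 hj).1, qBar_length, List.length_map, List.length_map]
  · cases N with
    | nil => simp
    | cons c N => simpa using hN

/-- The function `f̃` evaluated on the circle of radius `ρ`. -/
noncomputable def fTildeAt (ρ : ℝ) (L : List (ℕ × ℕ)) (σ : ℝ) : ℂ :=
  blockFun ρ ((L.takeWhile fun a => a.2 == 0).map Prod.fst) (L.dropWhile fun a => a.2 == 0) σ

theorem fTildeAt_one (L : List (ℕ × ℕ)) (σ : ℝ) : fTildeAt 1 L σ = fTilde L σ := by
  have h : (L.map Prod.fst).sum + (L.takeWhile fun a => a.2 == 0).length =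
      ((L.takeWhile fun a => a.2 == 0).map Prod.fst).sum +
        ((L.takeWhile fun a => a.2 == 0).map Prod.fst).length +
        ((L.dropWhile fun a => a.2 == 0).map Prod.fst).sum := by
    conv_lhs => rw [← List.takeWhile_append_dropWhile (p := fun a => a.2 == 0) (l := L)]
    rw [List.map_append, List.sum_append, List.length_map,
      List.takeWhile_append_dropWhile (p := fun a => a.2 == 0) (l := L)]
    omega
  simp only [fTildeAt, blockFun, fTilde, h, Complex.ofReal_one, one_mul]

theorem head?_dropWhile_pos (L : List (ℕ × ℕ)) :
    ∀ p ∈ (L.dropWhile fun a => a.2 == 0).head?, 0 < p.2 := by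
  intro p hp
  have := List.head?_dropWhile_not (fun a : ℕ × ℕ => a.2 == 0) L
  rw [Option.mem_def.1 hp] at this
  simp at this
  omega

theorem hasDerivAt_fTildeAt {ρ : ℝ} (hρ : ρ ∈ Ico (0 : ℝ) 1) (M : List (ℕ × ℕ)) (a : ℕ × ℕ)
    (σ : ℝ) : HasDerivAt (fTildeAt ρ (M ++ [a]))
      (Complex.I * (Complex.I * σ) ^ a.1 *
        evalA (ρ * Complex.exp (Complex.I * σ)) (letter e1) ^ a.2 * fTildeAt ρ M σ) σ := by
  have hd := head?_dropWhile_pos (M ++ [a])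
  unfold fTildeAt
  by_cases hM : (M.dropWhile fun a => a.2 == 0) = []
  · have hM' : ∀ x ∈ M, (x.2 == 0) = true := List.dropWhile_eq_nil_iff.1 hM
    have hT : (M.takeWhile fun a => a.2 == 0) = M := List.takeWhile_eq_self_iff.2 hM'
    have h1 : ((M ++ [a]).takeWhile fun a => a.2 == 0) =
        M ++ [a].takeWhile fun a => a.2 == 0 := List.takeWhile_append_of_pos hM'
    have h2 : ((M ++ [a]).dropWhile fun a => a.2 == 0) =
        [a].dropWhile fun a => a.2 == 0 := List.dropWhile_append_of_pos hM'
    rw [h2] at hd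
    rw [h1, h2, hM, hT]
    by_cases ha : a.2 = 0
    · simp only [List.takeWhile, List.dropWhile, ha, beq_self_eq_true, List.map_append,
        List.map_singleton, pow_zero, mul_one]
      exact hasDerivAt_blockFun_nil ρ _ a.1 σ
    · have ha' : (a.2 == 0) = false := by simpa using ha
      simp only [List.takeWhile, List.dropWhile, ha', List.append_nil] at hd ⊢
      exact hasDerivAt_blockFun hρ _ [] a hd σ
  · have h1 : ((M ++ [a]).takeWhile fun a => a.2 == 0) = M.takeWhile fun a => a.2 == 0 := by
      rw [List.takeWhile_append, if_neg]
      intro h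
      apply hM
      have := congrArg List.length
        (List.takeWhile_append_dropWhile (p := fun a : ℕ × ℕ => a.2 == 0) (l := M))
      rw [List.length_append, h] at this
      exact List.length_eq_zero_iff.1 (by omega)
    have h2 : ((M ++ [a]).dropWhile fun a => a.2 == 0) =
        (M.dropWhile fun a => a.2 == 0) ++ [a] := by
      rw [List.dropWhile_append, if_neg (by simpa using hM)]
    rw [h2] at hd
    rw [h1, h2]
    exact hasDerivAt_blockFun hρ _ _ a hd σ

theorem continuousOn_fTildeAt (L : List (ℕ × ℕ)) :
    ContinuousOn (fun p : ℝ × ℝ => fTildeAt p.1 L p.2) (Icc 0 1 ×ˢ univ) :=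
  continuousOn_blockFun _ _ (head?_dropWhile_pos L)

theorem continuous_fTilde (L : List (ℕ × ℕ)) : Continuous (fTilde L) := by
  have : fTilde L = fun σ => fTildeAt 1 L σ := funext fun σ => (fTildeAt_one L σ).symm
  rw [this, ← continuousOn_univ]
  exact (continuousOn_fTildeAt L).comp (f := fun σ : ℝ => ((1 : ℝ), σ)) (by fun_prop)
    fun σ _ => by simp

theorem fTilde_snoc_sub (M : List (ℕ × ℕ)) (a : ℕ × ℕ) {σ : ℝ} (hσ : σ ∈ Icc 0 Real.pi) :
    fTilde (M ++ [a]) σ - fTilde (M ++ [a]) 0 =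
      ∫ θ in 0..σ, logCot θ ^ a.2 * (Complex.I * (Complex.I * θ) ^ a.1 * fTilde M θ) := by
  have hne : (𝓝[Ico (0 : ℝ) 1] 1).NeBot := by
    rw [← mem_closure_iff_nhdsWithin_neBot, closure_Ico (by norm_num)]
    simp
  have hc : ∀ τ : ℝ, Tendsto (fun ρ : ℝ => fTildeAt ρ (M ++ [a]) τ) (𝓝[Ico 0 1] 1)
      (𝓝 (fTilde (M ++ [a]) τ)) := fun τ => by
    rw [← fTildeAt_one]
    have h3 : ContinuousOn (fun ρ : ℝ => fTildeAt ρ (M ++ [a]) τ) (Icc 0 1) :=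
      (continuousOn_fTildeAt (M ++ [a])).comp (f := fun ρ : ℝ => (ρ, τ)) (by fun_prop)
        fun ρ hρ => ⟨hρ, trivial⟩
    exact (h3 1 (by simp)).mono_left (nhdsWithin_mono _ Ico_subset_Icc_self)
  have h1 := tendsto_integral_evalA_e1
    (φ := fun p : ℝ × ℝ => Complex.I * (Complex.I * p.2) ^ a.1 * fTildeAt p.1 M p.2)
    (ContinuousOn.mul (by fun_prop) (continuousOn_fTildeAt M)) a.2 hσ
  simp only [fTildeAt_one] at h1
  refine tendsto_nhds_unique ((hc σ).sub (hc 0)) (h1.congr' ?_)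
  filter_upwards [self_mem_nhdsWithin] with ρ hρ
  have hM : Continuous (fTildeAt ρ M) := by
    rw [← continuousOn_univ]
    exact (continuousOn_fTildeAt M).comp (f := fun σ : ℝ => (ρ, σ)) (by fun_prop)
      fun σ _ => ⟨Ico_subset_Icc_self hρ, trivial⟩
  have he := continuous_evalA_e1 hρ
  rw [← intervalIntegral.integral_eq_sub_of_hasDerivAt
    (fun θ _ => hasDerivAt_fTildeAt hρ M a θ)]
  · refine intervalIntegral.integral_congr fun θ _ => ?_
    ring
  · refine Continuous.intervalIntegrable ?_ _ _
    exact ((by fun_prop : Continuous fun θ : ℝ => Complex.I * (Complex.I * (θ : ℂ)) ^ a.1).mul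
      (he.pow a.2)).mul hM

end LogTan

namespace LogTan

open Letter Set MeasureTheory Filter Topology

/-! ### Cuttings into blocks -/

theorem exists_concat_of_mem_blockSet {M : List (ℕ × ℕ)} (hM : M ≠ [])
    {P : List (List (ℕ × ℕ))} (hP : P ∈ blockSet M) :
    ∃ Q b, P = Q ++ [b] ∧ b ≠ [] ∧ Q.flatten ++ b = M ∧ ∀ c ∈ Q, c ≠ [] := by
  obtain ⟨h1, h2⟩ := (mem_blockSet _ _).1 hP
  rcases P.eq_nil_or_concat' with rfl | ⟨Q, b, rfl⟩
  · simp at h1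
    exact absurd h1 hM
  · exact ⟨Q, b, rfl, h2 b (by simp), by simpa using h1, fun c hc => h2 c (by simp [hc])⟩

/-- The cutting obtained by adding `a` to the last block. -/
def extendLast (a : ℕ × ℕ) (P : List (List (ℕ × ℕ))) : List (List (ℕ × ℕ)) :=
  P.dropLast ++ [P.getLastD [] ++ [a]]

theorem extendLast_concat (a : ℕ × ℕ) (Q : List (List (ℕ × ℕ))) (b : List (ℕ × ℕ)) :
    extendLast a (Q ++ [b]) = Q ++ [b ++ [a]] := by
  simp [extendLast]

theorem blockSet_snoc {M : List (ℕ × ℕ)} (hM : M ≠ []) (a : ℕ × ℕ) :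
    blockSet (M ++ [a]) =
      (blockSet M).image (fun P => P ++ [[a]]) ∪ (blockSet M).image (extendLast a) := by
  ext R
  rw [Finset.mem_union, Finset.mem_image, Finset.mem_image]
  constructor
  · intro hR
    obtain ⟨Q, c, rfl, hc, h1, h2⟩ := exists_concat_of_mem_blockSet (by simp) hR
    rcases c.eq_nil_or_concat' with rfl | ⟨b, x, rfl⟩
    · exact absurd rfl hc
    rw [← List.append_assoc] at h1
    obtain ⟨h3, h4⟩ := List.append_inj' h1 rfl
    simp only [List.cons.injEq, and_true] at h4
    subst h4
    by_cases hb : b = []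
    · subst hb
      exact Or.inl ⟨Q, (mem_blockSet _ _).2 ⟨by simpa using h3, h2⟩, rfl⟩
    · refine Or.inr ⟨Q ++ [b], (mem_blockSet _ _).2 ⟨by simpa using h3, fun d hd => ?_⟩,
        extendLast_concat _ _ _⟩
      rcases List.mem_append.1 hd with hd | hd
      · exact h2 d hd
      · rw [List.mem_singleton.1 hd]
        exact hb
  · rintro (⟨P, hP, rfl⟩ | ⟨P, hP, rfl⟩)
    · obtain ⟨h1, h2⟩ := (mem_blockSet _ _).1 hP
      refine (mem_blockSet _ _).2 ⟨by simp [h1], fun d hd => ?_⟩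
      rcases List.mem_append.1 hd with hd | hd
      · exact h2 d hd
      · rw [List.mem_singleton.1 hd]
        simp
    · obtain ⟨Q, b, rfl, hb, h1, h2⟩ := exists_concat_of_mem_blockSet hM hP
      rw [extendLast_concat]
      refine (mem_blockSet _ _).2 ⟨by simp [← h1], fun d hd => ?_⟩
      rcases List.mem_append.1 hd with hd | hd
      · exact h2 d hd
      · rw [List.mem_singleton.1 hd]
        simp

theorem sum_blockSet_snoc {E : Type*} [AddCommMonoid E] {M : List (ℕ × ℕ)} (hM : M ≠ [])
    (a : ℕ × ℕ) (g : List (List (ℕ × ℕ)) → E) :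
    ∑ P ∈ blockSet (M ++ [a]), g P =
      ∑ P ∈ blockSet M, (g (P ++ [[a]]) + g (extendLast a P)) := by
  rw [blockSet_snoc hM, Finset.sum_union, Finset.sum_image, Finset.sum_image,
    Finset.sum_add_distrib]
  · intro P hP P' hP' h
    obtain ⟨Q, b, rfl, -⟩ := exists_concat_of_mem_blockSet hM hP
    obtain ⟨Q', b', rfl, -⟩ := exists_concat_of_mem_blockSet hM hP'
    rw [extendLast_concat, extendLast_concat] at h
    obtain ⟨rfl, h2⟩ := List.append_inj' h rfl
    simpa using h2
  · intro P _ P' _ h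
    exact (List.append_inj' h rfl).1
  · rw [Finset.disjoint_left]
    intro R hR hR'
    obtain ⟨P, -, rfl⟩ := Finset.mem_image.1 hR
    obtain ⟨P', hP', h⟩ := Finset.mem_image.1 hR'
    obtain ⟨Q, b, rfl, hb, -⟩ := exists_concat_of_mem_blockSet hM hP'
    rw [extendLast_concat] at h
    obtain ⟨-, h2⟩ := List.append_inj' h rfl
    simp only [List.cons.injEq, and_true] at h2
    have := congrArg List.length h2
    simp only [List.length_append, List.length_singleton, Nat.add_eq_right] at this
    exact hb (List.length_eq_zero_iff.1 this)

/-! ### `F̃` as an iterated integral -/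

theorem fTilde_nil (σ : ℝ) : fTilde [] σ = 1 := by
  rw [← fTildeAt_one]
  simp [fTildeAt, blockFun_nil, coeffB]

theorem continuous_FTildeList (L : List (ℕ × ℕ)) : Continuous (FTildeList L) := by
  unfold FTildeList
  split_ifs
  · exact continuous_const
  · exact continuous_finsetSum _ fun P _ =>
      continuous_const.mul ((continuous_fTilde _).sub continuous_const)

theorem FTildeList_singleton (a : ℕ × ℕ) (σ : ℝ) :
    FTildeList [a] σ = fTilde [a] σ - fTilde [a] 0 := by
  simp [FTildeList, blockSet, blockList]

theorem intervalIntegrable_kernel_mul {φ : ℝ → ℂ} (hφ : Continuous φ) (a : ℕ × ℕ) {σ : ℝ}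
    (hσ : σ ∈ Icc 0 Real.pi) : IntervalIntegrable
      (fun θ : ℝ => logCot θ ^ a.2 * (Complex.I * (Complex.I * θ) ^ a.1 * φ θ)) volume 0 σ :=
  intervalIntegrable_logCot_mul
    ((by fun_prop : Continuous fun θ : ℝ => Complex.I * (Complex.I * (θ : ℂ)) ^ a.1).mul
      hφ).continuousOn a.2 hσ

theorem FTildeList_snoc (M : List (ℕ × ℕ)) (a : ℕ × ℕ) {σ : ℝ} (hσ : σ ∈ Icc 0 Real.pi) :
    FTildeList (M ++ [a]) σ =
      ∫ θ in 0..σ, logCot θ ^ a.2 * (Complex.I * (Complex.I * θ) ^ a.1 * FTildeList M θ) := by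
  by_cases hM : M = []
  · subst hM
    have h1 := fTilde_snoc_sub [] a hσ
    simp only [fTilde_nil, List.nil_append] at h1
    simp only [List.nil_append, FTildeList_singleton, h1]
    simp [FTildeList]
  have h0 := fTilde_snoc_sub [] a hσ
  rw [List.nil_append] at h0
  simp only [FTildeList, hM, List.append_eq_nil_iff, false_and, if_false]
  rw [sum_blockSet_snoc hM]
  simp only [Finset.mul_sum]
  rw [intervalIntegral.integral_finsetSum fun P _ => intervalIntegrable_kernel_mul
    (φ := fun θ => (-1) ^ (P.length - 1) * (P.dropLast.map fun b => fTilde b 0).prod *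
      (fTilde (P.getLastD []) θ - fTilde (P.getLastD []) 0))
    (continuous_const.mul ((continuous_fTilde _).sub continuous_const)) a hσ]
  refine Finset.sum_congr rfl fun P hP => ?_
  obtain ⟨Q, b, rfl, -⟩ := exists_concat_of_mem_blockSet hM hP
  rw [extendLast_concat]
  simp only [List.length_append, List.length_singleton, List.dropLast_concat, List.getLastD_concat,
    Nat.add_sub_cancel, List.map_append, List.map_singleton, List.prod_append, List.prod_singleton]
  have h1 : ∀ θ : ℝ, logCot θ ^ a.2 * (Complex.I * (Complex.I * (θ : ℂ)) ^ a.1 *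
      ((-1) ^ Q.length * (Q.map fun b => fTilde b 0).prod * (fTilde b θ - fTilde b 0))) =
      (-1) ^ Q.length * (Q.map fun b => fTilde b 0).prod *
        (logCot θ ^ a.2 * (Complex.I * (Complex.I * (θ : ℂ)) ^ a.1 * fTilde b θ) -
        fTilde b 0 * (logCot θ ^ a.2 * (Complex.I * (Complex.I * (θ : ℂ)) ^ a.1 *
          fTilde [] θ))) := fun θ => by
    rw [fTilde_nil]
    ring
  simp only [h1]
  rw [intervalIntegral.integral_const_mul, intervalIntegral.integral_sub
    (intervalIntegrable_kernel_mul (continuous_fTilde b) a hσ)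
    ((intervalIntegrable_kernel_mul (continuous_fTilde []) a hσ).const_mul _),
    intervalIntegral.integral_const_mul, ← h0, ← fTilde_snoc_sub b a hσ]
  ring

theorem continuous_FTilde {n : ℕ} (q r : Fin n → ℕ) : Continuous (FTilde q r) :=
  continuous_FTildeList _

theorem FTilde_succ {n : ℕ} (q r : Fin (n + 1) → ℕ) {σ : ℝ} (hσ : σ ∈ Icc 0 Real.pi) :
    FTilde q r σ = ∫ θ in 0..σ, logCot θ ^ r (Fin.last n) *
      (Complex.I * (Complex.I * θ) ^ q (Fin.last n) *
        FTilde (fun u : Fin n => q u.castSucc) (fun u : Fin n => r u.castSucc) θ) := by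
  unfold FTilde
  rw [List.ofFn_succ', List.concat_eq_append, FTildeList_snoc _ _ hσ]

/-! ### The log-tangent integrals -/

theorem sum_piFinset_succ {β E : Type*} [DecidableEq β] [AddCommMonoid E] {n : ℕ}
    (t : Fin (n + 1) → Finset β) (g : (Fin (n + 1) → β) → E) :
    ∑ a ∈ Fintype.piFinset t, g a = ∑ b ∈ t (Fin.last n),
      ∑ a ∈ Fintype.piFinset fun u : Fin n => t u.castSucc, g (Fin.snoc (α := fun _ => β) a b) := by
  rw [← Finset.sum_product']
  refine Finset.sum_nbij' (fun a => (a (Fin.last n), fun u => a u.castSucc))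
    (fun p => Fin.snoc (α := fun _ => β) p.2 p.1) ?_ ?_ ?_ ?_ ?_
  · intro a ha
    rw [Fintype.mem_piFinset] at ha
    rw [Finset.mem_product, Fintype.mem_piFinset]
    exact ⟨ha _, fun u => ha _⟩
  · intro p hp
    rw [Finset.mem_product, Fintype.mem_piFinset] at hp
    rw [Fintype.mem_piFinset]
    intro u
    induction u using Fin.lastCases with
    | last => simpa using hp.1
    | cast u => simpa using hp.2 u
  · intro a _
    exact Fin.snoc_init_self a
  · intro p _
    simp
  · intro a _
    exact congrArg g (Fin.snoc_init_self a).symm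

theorem neg_kernel_eq {k l : ℕ} (h : l + 1 ≤ k) (θ : ℝ) :
    -((θ : ℂ) ^ l * ((Real.log |Real.tan (θ / 2)| : ℝ) : ℂ) ^ (k - 1 - l)) =
      (-1) ^ (k + 1) * Complex.I ^ (l + 1) *
        ∑ p ∈ Finset.HasAntidiagonal.antidiagonal (k - 1 - l),
          ((k - 1 - l).factorial : ℂ) / ((p.1.factorial : ℂ) * (p.2.factorial : ℂ)) *
            (-((Real.pi : ℂ) / 2) * Complex.I) ^ p.1 *
            (logCot θ ^ p.2 * (Complex.I * (Complex.I * θ) ^ l)) := by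
  have h1 : ((Real.log |Real.tan (θ / 2)| : ℝ) : ℂ) =
      -(-((Real.pi : ℂ) / 2) * Complex.I + logCot θ) := by
    rw [logCot]
    ring
  obtain ⟨m, rfl⟩ : ∃ m, k = l + 1 + m := ⟨k - (l + 1), by omega⟩
  have hm : l + 1 + m - 1 - l = m := by omega
  rw [h1, neg_pow, hm, (Commute.all _ _).add_pow']
  have h2 : ∀ p ∈ Finset.HasAntidiagonal.antidiagonal m,
      ((m.choose p.1 : ℕ) : ℂ) = (m.factorial : ℂ) / ((p.1.factorial : ℂ) * (p.2.factorial : ℂ)) :=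
    fun p hp => by
    have hp := Finset.HasAntidiagonal.mem_antidiagonal.1 hp
    subst hp
    rw [Nat.cast_add_choose]
  rw [Finset.mul_sum, Finset.mul_sum, Finset.mul_sum, ← Finset.sum_neg_distrib]
  refine Finset.sum_congr rfl fun p hp => ?_
  rw [nsmul_eq_mul, h2 p hp, mul_pow Complex.I]
  have h3 : Complex.I ^ l * Complex.I ^ l = (-1) ^ l := by
    rw [← mul_pow, Complex.I_mul_I]
  have h4 : Complex.I ^ (l + 1) * (Complex.I * Complex.I ^ l) = -(-1) ^ l := by
    rw [pow_succ, show Complex.I ^ l * Complex.I * (Complex.I * Complex.I ^ l) =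
      Complex.I ^ l * Complex.I ^ l * (Complex.I * Complex.I) by ring, h3, Complex.I_mul_I]
    ring
  have h5 : (-1 : ℂ) ^ (l + 1 + m + 1) * (-1) ^ l = (-1) ^ m := by
    rw [← pow_add, show l + 1 + m + 1 + l = 2 * (l + 1) + m by ring, pow_add, pow_mul, neg_one_sq,
      one_pow, one_mul]
  generalize (m.factorial : ℂ) / ((p.1.factorial : ℂ) * (p.2.factorial : ℂ)) = F
  generalize (-((Real.pi : ℂ) / 2) * Complex.I) ^ p.1 = x
  generalize logCot θ ^ p.2 = y
  generalize (θ : ℂ) ^ l = w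
  linear_combination (-((-1) ^ (l + 1 + m + 1) * (F * x * y * w))) * h4 + (F * x * y * w) * h5

theorem intervalIntegrable_fun_sum {ι : Type*} (s : Finset ι) {f : ι → ℝ → ℂ} {a b : ℝ}
    (h : ∀ i ∈ s, IntervalIntegrable (f i) volume a b) :
    IntervalIntegrable (fun x => ∑ i ∈ s, f i x) volume a b := by
  have := IntervalIntegrable.sum s h
  rwa [Finset.sum_fn] at this

theorem Lt_eq : ∀ (n : ℕ) (k l : Fin n → ℕ), (∀ u, l u + 1 ≤ k u) → ∀ σ ∈ Icc (0 : ℝ) Real.pi,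
    (Lt k l σ : ℂ) =
      (-1) ^ ((∑ u, k u) + n) * Complex.I ^ ((∑ u, l u) + n) *
        ∑ a ∈ Fintype.piFinset fun u => Finset.HasAntidiagonal.antidiagonal (k u - 1 - l u),
          (∏ u, (Nat.factorial (k u - 1 - l u) : ℂ) /
            ((Nat.factorial (a u).1 : ℂ) * (Nat.factorial (a u).2 : ℂ))) *
          (-((Real.pi : ℂ) / 2) * Complex.I) ^ (∑ u, (a u).1) *
          FTilde l (fun u => (a u).2) σ
  | 0, k, l, _, σ, _ => by
    simp [Lt, FTilde, FTildeList]
  | n + 1, k, l, h, σ, hσ => by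
    have ih := Lt_eq n (Fin.init k) (Fin.init l) fun u => h u.castSucc
    rw [Lt, Complex.ofReal_neg, ← intervalIntegral.integral_ofReal,
      ← intervalIntegral.integral_neg]
    have h1 : ∀ θ ∈ uIcc 0 σ, -((θ ^ l (Fin.last n) *
        Real.log |Real.tan (θ / 2)| ^ (k (Fin.last n) - 1 - l (Fin.last n)) *
        Lt (Fin.init k) (Fin.init l) θ : ℝ) : ℂ) =
        ∑ p ∈ Finset.HasAntidiagonal.antidiagonal (k (Fin.last n) - 1 - l (Fin.last n)),
        ∑ a ∈ Fintype.piFinset fun u : Fin n => Finset.HasAntidiagonal.antidiagonal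
          (k u.castSucc - 1 - l u.castSucc),
          ((-1) ^ (k (Fin.last n) + 1) * Complex.I ^ (l (Fin.last n) + 1) *
          (((k (Fin.last n) - 1 - l (Fin.last n)).factorial : ℂ) /
            ((p.1.factorial : ℂ) * (p.2.factorial : ℂ)) *
            (-((Real.pi : ℂ) / 2) * Complex.I) ^ p.1) *
          ((-1) ^ ((∑ u : Fin n, k u.castSucc) + n) *
            Complex.I ^ ((∑ u : Fin n, l u.castSucc) + n) *
            ((∏ u : Fin n, (Nat.factorial (k u.castSucc - 1 - l u.castSucc) : ℂ) /
              ((Nat.factorial (a u).1 : ℂ) * (Nat.factorial (a u).2 : ℂ))) *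
            (-((Real.pi : ℂ) / 2) * Complex.I) ^ (∑ u, (a u).1)))) *
          (logCot θ ^ p.2 * (Complex.I * (Complex.I * θ) ^ l (Fin.last n) *
            FTilde (fun u : Fin n => l u.castSucc) (fun u => (a u).2) θ)) := by
      intro θ hθ
      rw [uIcc_of_le hσ.1] at hθ
      rw [Complex.ofReal_mul, ih θ ⟨hθ.1, hθ.2.trans hσ.2⟩, ← neg_mul]
      push_cast
      rw [neg_kernel_eq (h (Fin.last n)), Finset.mul_sum, Finset.mul_sum, Finset.sum_mul]
      refine Finset.sum_congr rfl fun p _ => ?_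
      rw [Finset.mul_sum]
      refine Finset.sum_congr rfl fun a _ => ?_
      rw [show (Fin.init l : Fin n → ℕ) = fun u => l u.castSucc from rfl,
        show (Fin.init k : Fin n → ℕ) = fun u => k u.castSucc from rfl]
      ring
    rw [intervalIntegral.integral_congr h1, intervalIntegral.integral_finsetSum
      fun p _ => intervalIntegrable_fun_sum _ fun a _ => IntervalIntegrable.const_mul
        (intervalIntegrable_kernel_mul (continuous_FTilde _ _) (l (Fin.last n), p.2) hσ) _,
      sum_piFinset_succ, Finset.mul_sum]
    refine Finset.sum_congr rfl fun p _ => ?_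
    rw [intervalIntegral.integral_finsetSum
      fun a _ => IntervalIntegrable.const_mul
        (intervalIntegrable_kernel_mul (continuous_FTilde _ _) (l (Fin.last n), p.2) hσ) _,
      Finset.mul_sum]
    refine Finset.sum_congr rfl fun a _ => ?_
    rw [intervalIntegral.integral_const_mul, FTilde_succ _ _ hσ]
    simp only [Fin.sum_univ_castSucc, Fin.prod_univ_castSucc, Fin.snoc_castSucc, Fin.snoc_last]
    ring

end LogTan

namespace LogTan

open Letter Set

/-! ### Spans of multiple `T`-values and multiple `A`-functions -/

/-- The `ℚ`-span of the `T`-values of weight `wt` and depth `dp`. -/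
noncomputable def spanT (wt dp : ℕ) : Submodule ℚ ℂ :=
  Submodule.span ℚ {c | ∃ k : List ℕ, Admissible k ∧ k.sum = wt ∧ k.length = dp ∧
    c = multipleT k}

/-- The `ℚ`-span of the functions `(iσ)^m A(k; e^{iσ})` of weight `wt` and depth `dp`. -/
noncomputable def spanA (wt dp : ℕ) : Submodule ℚ (Icc (0 : ℝ) Real.pi → ℂ) :=
  Submodule.span ℚ {g | ∃ (m : ℕ) (k : List ℕ), Admissible k ∧ m + k.sum = wt ∧ k.length = dp ∧
    g = fun σ : Icc (0 : ℝ) Real.pi => (Complex.I * ((σ : ℝ) : ℂ)) ^ m *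
      multipleA k (Complex.exp (Complex.I * ((σ : ℝ) : ℂ)))}

theorem sum_wordIndex_add (w : List Letter) : (wordIndex w).sum + leadingE0 w = w.length := by
  induction w with
  | nil => rfl
  | cons c w ih =>
    cases c
    · simp only [wordIndex, leadingE0, List.length_cons]
      omega
    · simp only [wordIndex, leadingE0, List.length_cons, List.sum_cons]
      omega

theorem length_wordIndex (w : List Letter) : (wordIndex w).length = w.count e1 := by
  induction w with
  | nil => rfl
  | cons c w ih => cases c <;> simp [wordIndex, ih]

theorem one_le_of_mem_wordIndex {w : List Letter} : ∀ a ∈ wordIndex w, 1 ≤ a := by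
  induction w with
  | nil => simp [wordIndex]
  | cons c w ih =>
    cases c
    · simpa [wordIndex] using ih
    · intro a ha
      rcases List.mem_cons.1 ha with rfl | ha
      · omega
      · exact ih a ha

theorem count_e0_add_count_e1 (w : List Letter) : w.count e0 + w.count e1 = w.length := by
  induction w with
  | nil => rfl
  | cons c w ih =>
    cases c <;> simp <;> omega

theorem wordIndex_of_admWords {a b : ℕ} {w : List Letter} (hw : w ∈ admWords a b) :
    Admissible (wordIndex w) ∧ (wordIndex w).sum = a + b ∧ (wordIndex w).length = b := by
  obtain ⟨⟨h1, h2, h3⟩, h4⟩ := hw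
  refine ⟨⟨one_le_of_mem_wordIndex, ?_⟩, ?_, by rw [length_wordIndex, h2]⟩
  · rcases w.eq_nil_or_concat' with rfl | ⟨u, c, rfl⟩
    · simp [wordIndex]
    · obtain rfl := h4 c (by simp)
      rcases wordIndex_snoc_e0 u with ⟨-, h⟩ | ⟨k, a, ha, -, h⟩
      · simp [h]
      · rw [h]
        simpa using ha
  · have h5 : leadingE0 w = 0 := by
      cases w with
      | nil => rfl
      | cons c w =>
        obtain rfl := h3 c (by simp)
        rfl
    have := sum_wordIndex_add w
    have := count_e0_add_count_e1 w
    omega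

theorem indexWord_mem_admWords {k : List ℕ} (hk : Admissible k) :
    ∃ a, indexWord k ∈ admWords a k.length ∧ a + k.length = k.sum := by
  have h1 : ∀ k : List ℕ, (∀ a ∈ k, 1 ≤ a) → (indexWord k).count e1 = k.length ∧
      (indexWord k).count e0 + k.length = k.sum := by
    intro k hk
    induction k with
    | nil => simp [indexWord]
    | cons a k ih =>
      obtain ⟨h1, h2⟩ := ih fun b hb => hk b (by simp [hb])
      have ha := hk a (by simp)
      constructor
      · simp [indexWord, List.count_replicate, h1]
      · simp [indexWord]
        omega
  have h2 : ∀ k : List ℕ, (∀ a ∈ k.getLast?, 2 ≤ a) → ∀ x ∈ (indexWord k).getLast?, x = e0 := by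
    intro k hk
    induction k with
    | nil => simp [indexWord]
    | cons a k ih =>
      rcases k.eq_nil_or_concat' with rfl | ⟨k', c, rfl⟩
      · have ha : 2 ≤ a := hk a (by simp)
        obtain ⟨m, rfl⟩ : ∃ m, a = m + 2 := ⟨a - 2, by omega⟩
        have h : indexWord [m + 2] = (e1 :: List.replicate m e0) ++ [e0] := by
          simp [indexWord, List.replicate_succ']
        rw [h, List.getLast?_concat]
        simp
      · intro x hx
        refine ih (fun b hb => hk b (by
          rw [List.getLast?_concat] at hb
          rwa [← List.cons_append, List.getLast?_concat])) x ?_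
        have hne : indexWord (k' ++ [c]) ≠ [] := by
          cases k' <;> simp [indexWord]
        rw [indexWord, ← List.cons_append, List.getLast?_append_of_ne_nil _ hne] at hx
        exact hx
  obtain ⟨h3, h4⟩ := h1 k hk.1
  refine ⟨(indexWord k).count e0, ⟨⟨rfl, h3, ?_⟩, h2 k hk.2⟩, h4⟩
  cases k <;> simp [indexWord]

theorem evalA_one_mem_spanT {a b : ℕ} {x : NCPoly} (hx : x ∈ wordSpan (admWords a b)) :
    evalA 1 x ∈ spanT (a + b) b := by
  refine wordSpan_induction (p := fun x => evalA 1 x ∈ spanT (a + b) b) ?_ (by simp)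
    (fun x y hx hy => by rw [map_add]; exact add_mem hx hy)
    (fun c x hx => by rw [map_smul]; exact Submodule.smul_mem _ c hx) hx
  intro w hw
  obtain ⟨h1, h2, h3⟩ := wordIndex_of_admWords hw
  rw [evalA_wd, multipleA_one]
  exact Submodule.subset_span ⟨_, h1, h2, h3, rfl⟩

theorem evalA_mem_spanA {a b : ℕ} {x : NCPoly} (hx : x ∈ wordSpan (admWords a b)) (m : ℕ) :
    (fun σ : Icc (0 : ℝ) Real.pi => (Complex.I * ((σ : ℝ) : ℂ)) ^ m *
      evalA (Complex.exp (Complex.I * ((σ : ℝ) : ℂ))) x) ∈ spanA (m + (a + b)) b := by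
  refine wordSpan_induction (p := fun x => (fun σ : Icc (0 : ℝ) Real.pi =>
    (Complex.I * ((σ : ℝ) : ℂ)) ^ m * evalA (Complex.exp (Complex.I * ((σ : ℝ) : ℂ))) x) ∈
      spanA (m + (a + b)) b) ?_ ?_ ?_ ?_ hx
  · intro w hw
    obtain ⟨h1, h2, h3⟩ := wordIndex_of_admWords hw
    simp only [evalA_wd]
    exact Submodule.subset_span ⟨m, _, h1, by rw [h2], h3, rfl⟩
  · simp only [map_zero, mul_zero]
    exact zero_mem _
  · intro x y hx hy
    simp only [map_add, mul_add]
    exact add_mem hx hy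
  · intro c x hx
    simp only [map_smul, mul_smul_comm]
    exact Submodule.smul_mem _ c hx

theorem multipleT_mul_multipleT_mem {k k' : List ℕ} (hk : Admissible k) (hk' : Admissible k') :
    (multipleT k : ℂ) * multipleT k' ∈ spanT (k.sum + k'.sum) (k.length + k'.length) := by
  obtain ⟨a, h1, h2⟩ := indexWord_mem_admWords hk
  obtain ⟨a', h1', h2'⟩ := indexWord_mem_admWords hk'
  have h3 : ∀ k : List ℕ, Admissible k → (multipleT k : ℂ) = evalA 1 (wd (indexWord k)) :=
    fun k hk => by rw [evalA_wd, wordIndex_indexWord k hk.1, multipleA_one]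
  have hz : ‖(1 : ℂ)‖ ≤ 1 := by simp
  rw [h3 k hk, h3 k' hk', ← evalA_shuffle_adm hz (wd_mem_wordSpan h1) (wd_mem_wordSpan h1')]
  convert! evalA_one_mem_spanT
    (shuffle_mem_admWords (wd_mem_wordSpan h1) (wd_mem_wordSpan h1')) using 2
  omega

theorem mul_mem_spanT {w d w' d' : ℕ} {x y : ℂ} (hx : x ∈ spanT w d) (hy : y ∈ spanT w' d') :
    x * y ∈ spanT (w + w') (d + d') := by
  refine Submodule.span_induction (p := fun x _ => x * y ∈ spanT (w + w') (d + d')) ?_ (by simp)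
    (fun x x' _ _ hx hx' => by rw [add_mul]; exact add_mem hx hx')
    (fun c x _ hx => by rw [smul_mul_assoc]; exact Submodule.smul_mem _ c hx) hx
  rintro _ ⟨k, hk, rfl, rfl, rfl⟩
  refine Submodule.span_induction
    (p := fun y _ => (multipleT k : ℂ) * y ∈ spanT (k.sum + w') (k.length + d')) ?_ (by simp)
    (fun x x' _ _ hx hx' => by rw [mul_add]; exact add_mem hx hx')
    (fun c x _ hx => by rw [mul_smul_comm]; exact Submodule.smul_mem _ c hx) hy
  rintro _ ⟨k', hk', rfl, rfl, rfl⟩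
  exact multipleT_mul_multipleT_mem hk hk'

theorem one_mem_spanT : (1 : ℂ) ∈ spanT 0 0 := by
  have := evalA_one_mem_spanT (a := 0) (b := 0) (x := 1)
    (by rw [← wd_nil]; exact wd_mem_wordSpan ⟨⟨by simp, by simp, by simp⟩, by simp⟩)
  rwa [evalA_one] at this

theorem one_mem_spanA : (fun _ => 1) ∈ spanA 0 0 := by
  have := evalA_mem_spanA (a := 0) (b := 0) (x := 1)
    (by rw [← wd_nil]; exact wd_mem_wordSpan ⟨⟨by simp, by simp, by simp⟩, by simp⟩) 0
  simpa only [evalA_one, pow_zero, mul_one] using this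

theorem mul_mem_productsTA {w d w' d' : ℕ} {c : ℂ} {g : Icc (0 : ℝ) Real.pi → ℂ}
    (hc : c ∈ spanT w d) (hg : g ∈ spanA w' d') :
    (fun σ => c * g σ) ∈ Submodule.span ℚ (productsTA (w + w') (d + d')) := by
  refine Submodule.span_induction
    (p := fun c _ => (fun σ => c * g σ) ∈ Submodule.span ℚ (productsTA (w + w') (d + d')))
    ?_ (by simp only [zero_mul]; exact zero_mem _)
    (fun x x' _ _ hx hx' => by simp only [add_mul]; exact add_mem hx hx')
    (fun c x _ hx => by simp only [smul_mul_assoc]; exact Submodule.smul_mem _ c hx) hc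
  rintro _ ⟨k, hk, rfl, rfl, rfl⟩
  refine Submodule.span_induction
    (p := fun (g : Icc (0 : ℝ) Real.pi → ℂ) _ => (fun σ => (multipleT k : ℂ) * g σ) ∈
      Submodule.span ℚ (productsTA (k.sum + w') (k.length + d')))
    ?_ (by simp only [Pi.zero_apply, mul_zero]; exact zero_mem _)
    (fun x x' _ _ hx hx' => by simp only [Pi.add_apply, mul_add]; exact add_mem hx hx')
    (fun c x _ hx => by
      simp only [Pi.smul_apply, mul_smul_comm]; exact Submodule.smul_mem _ c hx) hg
  rintro _ ⟨m, k', hk', rfl, rfl, rfl⟩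
  refine Submodule.subset_span ⟨m, k, k', hk, hk', by omega, rfl, ?_⟩
  funext σ
  ring

/-- The weight of a list of pairs `(q_u, r_u)`. -/
def pairWeight (L : List (ℕ × ℕ)) : ℕ := (L.map Prod.fst).sum + (L.map Prod.snd).sum + L.length

/-- The depth of a list of pairs `(q_u, r_u)`. -/
def pairDepth (L : List (ℕ × ℕ)) : ℕ := (L.map Prod.snd).sum

theorem pairWeight_append (L M : List (ℕ × ℕ)) :
    pairWeight (L ++ M) = pairWeight L + pairWeight M := by
  simp [pairWeight]
  omega

theorem pairDepth_append (L M : List (ℕ × ℕ)) :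
    pairDepth (L ++ M) = pairDepth L + pairDepth M := by
  simp [pairDepth]

theorem takeWhile_dropWhile_weight (L : List (ℕ × ℕ)) :
    ((L.takeWhile fun a => a.2 == 0).map Prod.fst).sum +
        (L.takeWhile fun a => a.2 == 0).length +
        pairWeight (L.dropWhile fun a => a.2 == 0) = pairWeight L ∧
      pairDepth (L.dropWhile fun a => a.2 == 0) = pairDepth L := by
  have h0 : ((L.takeWhile fun a => a.2 == 0).map Prod.snd).sum = 0 := by
    rw [List.sum_eq_zero_iff]
    intro x hx
    obtain ⟨p, hp, rfl⟩ := List.mem_map.1 hx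
    have := List.mem_takeWhile_imp hp
    simpa using this
  have h1 := List.takeWhile_append_dropWhile (p := fun a : ℕ × ℕ => a.2 == 0) (l := L)
  have h2 := congrArg pairWeight h1
  have h3 := congrArg pairDepth h1
  rw [pairWeight_append, pairWeight, h0] at h2
  rw [pairDepth_append, pairDepth, h0] at h3
  omega

theorem wordW_mem_of_prec {q' : List ℕ} {N : List (ℕ × ℕ)} (hN : ∀ p ∈ N.head?, 0 < p.2)
    {j : List ℕ} (hj : j ∈ precSet (qBar q' (N.map Prod.fst))) :
    wordW j (N.map Prod.snd) ∈ wordSpan (admWords (j.sum + N.length) (pairDepth N)) ∧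
      j.sum ≤ q'.sum + q'.length + (N.map Prod.fst).sum := by
  have h1 := (mem_precSet _ _).1 hj
  have h2 : j.length = N.length := by rw [h1.1, qBar_length, List.length_map]
  refine ⟨?_, h1.sum_le.trans (qBar_sum_le _ _)⟩
  rw [← h2]
  refine wordW_mem (by rw [h2, List.length_map]) ?_
  cases N with
  | nil => simp
  | cons c N => simpa using hN

theorem ratCast_mul_mem {M : Submodule ℚ ℂ} (c : ℚ) {x : ℂ} (hx : x ∈ M) : (c : ℂ) * x ∈ M := by
  rw [← Rat.smul_def]
  exact Submodule.smul_mem _ c hx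

theorem ratCast_mul_fun_mem {α : Type*} {M : Submodule ℚ (α → ℂ)} (c : ℚ) {g : α → ℂ}
    (hg : g ∈ M) : (fun σ => (c : ℂ) * g σ) ∈ M := by
  have : (fun σ => (c : ℂ) * g σ) = c • g := by
    funext σ
    rw [Pi.smul_apply, Rat.smul_def]
  rw [this]
  exact Submodule.smul_mem _ c hg

theorem blockFun_zero_mem {q' : List ℕ} {N : List (ℕ × ℕ)} (hN : ∀ p ∈ N.head?, 0 < p.2) :
    blockFun 1 q' N 0 ∈ spanT (q'.sum + q'.length + pairWeight N) (pairDepth N) := by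
  rw [blockFun]
  refine ratCast_mul_mem _ (Submodule.sum_mem _ fun j hj => ?_)
  rw [mul_assoc]
  refine ratCast_mul_mem _ ?_
  obtain ⟨h1, h2⟩ := wordW_mem_of_prec hN hj
  rcases eq_or_ne (q'.sum + q'.length + (N.map Prod.fst).sum - j.sum) 0 with h | h
  · rw [h, pow_zero, one_mul, Complex.ofReal_zero, mul_zero, Complex.exp_zero, mul_one,
      Complex.ofReal_one]
    convert! evalA_one_mem_spanT h1 using 2
    simp only [pairWeight, pairDepth]
    omega
  · rw [Complex.ofReal_zero, mul_zero, zero_pow h, zero_mul]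
    exact zero_mem _

theorem blockFun_mem_spanA {q' : List ℕ} {N : List (ℕ × ℕ)} (hN : ∀ p ∈ N.head?, 0 < p.2) :
    (fun σ : Icc (0 : ℝ) Real.pi => blockFun 1 q' N σ) ∈
      spanA (q'.sum + q'.length + pairWeight N) (pairDepth N) := by
  unfold blockFun
  refine ratCast_mul_fun_mem _ ?_
  have : (fun σ : Icc (0 : ℝ) Real.pi => ∑ j ∈ precSet (qBar q' (N.map Prod.fst)),
      (coeffC (qBar q' (N.map Prod.fst)) j : ℂ) *
      (Complex.I * ((σ : ℝ) : ℂ)) ^ (q'.sum + q'.length + (N.map Prod.fst).sum - j.sum) *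
      evalA (((1 : ℝ) : ℂ) * Complex.exp (Complex.I * ((σ : ℝ) : ℂ))) (wordW j (N.map Prod.snd))) =
      ∑ j ∈ precSet (qBar q' (N.map Prod.fst)), fun σ : Icc (0 : ℝ) Real.pi =>
      (coeffC (qBar q' (N.map Prod.fst)) j : ℂ) *
      ((Complex.I * ((σ : ℝ) : ℂ)) ^ (q'.sum + q'.length + (N.map Prod.fst).sum - j.sum) *
      evalA (Complex.exp (Complex.I * ((σ : ℝ) : ℂ))) (wordW j (N.map Prod.snd))) := by
    rw [Finset.sum_fn]
    funext σ
    simp only [Complex.ofReal_one, one_mul, mul_assoc]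
  rw [this]
  refine Submodule.sum_mem _ fun j hj => ratCast_mul_fun_mem _ ?_
  obtain ⟨h1, h2⟩ := wordW_mem_of_prec hN hj
  convert! evalA_mem_spanA h1 _ using 2
  simp only [pairWeight, pairDepth]
  omega

theorem fTilde_zero_mem (L : List (ℕ × ℕ)) :
    fTilde L 0 ∈ spanT (pairWeight L) (pairDepth L) := by
  obtain ⟨h1, h2⟩ := takeWhile_dropWhile_weight L
  rw [← fTildeAt_one, fTildeAt, ← h1, ← h2]
  have := blockFun_zero_mem (q' := (L.takeWhile fun a => a.2 == 0).map Prod.fst)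
    (head?_dropWhile_pos L)
  rwa [List.length_map] at this

theorem fTilde_mem_spanA (L : List (ℕ × ℕ)) :
    (fun σ : Icc (0 : ℝ) Real.pi => fTilde L σ) ∈ spanA (pairWeight L) (pairDepth L) := by
  obtain ⟨h1, h2⟩ := takeWhile_dropWhile_weight L
  simp only [← fTildeAt_one, fTildeAt]
  rw [← h1, ← h2]
  have := blockFun_mem_spanA (q' := (L.takeWhile fun a => a.2 == 0).map Prod.fst)
    (head?_dropWhile_pos L)
  rwa [List.length_map] at this

theorem prod_fTilde_zero_mem (Q : List (List (ℕ × ℕ))) :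
    (Q.map fun b => fTilde b 0).prod ∈ spanT (pairWeight Q.flatten) (pairDepth Q.flatten) := by
  induction Q with
  | nil => simpa [pairWeight, pairDepth] using one_mem_spanT
  | cons b Q ih =>
    rw [List.map_cons, List.prod_cons, List.flatten_cons, pairWeight_append, pairDepth_append]
    exact mul_mem_spanT (fTilde_zero_mem b) ih

theorem FTildeList_mem (L : List (ℕ × ℕ)) :
    (fun σ : Icc (0 : ℝ) Real.pi => FTildeList L σ) ∈
      Submodule.span ℚ (productsTA (pairWeight L) (pairDepth L)) := by
  by_cases hL : L = []
  · subst hL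
    have := mul_mem_productsTA one_mem_spanT one_mem_spanA
    simpa [FTildeList, pairWeight, pairDepth] using this
  simp only [FTildeList, hL, if_false]
  have : (fun σ : Icc (0 : ℝ) Real.pi => ∑ P ∈ blockSet L,
      (-1) ^ (P.length - 1) * (P.dropLast.map fun b => fTilde b 0).prod *
      (fTilde (P.getLastD []) σ - fTilde (P.getLastD []) 0)) =
      ∑ P ∈ blockSet L, fun σ : Icc (0 : ℝ) Real.pi => (((-1) ^ (P.length - 1) : ℚ) : ℂ) *
        ((P.dropLast.map fun b => fTilde b 0).prod * fTilde (P.getLastD []) σ -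
        (P.dropLast.map fun b => fTilde b 0).prod * fTilde (P.getLastD []) 0 * 1) := by
    rw [Finset.sum_fn]
    funext σ
    refine Finset.sum_congr rfl fun P _ => ?_
    push_cast
    ring
  rw [this]
  refine Submodule.sum_mem _ fun P hP => ratCast_mul_fun_mem _ ?_
  obtain ⟨Q, b, rfl, -, h1, -⟩ := exists_concat_of_mem_blockSet hL hP
  simp only [List.dropLast_concat, List.getLastD_concat]
  rw [← h1, pairWeight_append, pairDepth_append]
  have h2 := mul_mem_productsTA (prod_fTilde_zero_mem Q) (fTilde_mem_spanA b)
  have h3 := mul_mem_productsTA (mul_mem_spanT (prod_fTilde_zero_mem Q) (fTilde_zero_mem b))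
    one_mem_spanA
  exact Submodule.sub_mem _ h2 h3

theorem FTilde_mem {n : ℕ} (q r : Fin n → ℕ) :
    (fun σ : Icc (0 : ℝ) Real.pi => FTilde q r σ) ∈
      Submodule.span ℚ (productsTA ((∑ u, r u) + (∑ u, q u) + n) (∑ u, r u)) := by
  have h := FTildeList_mem (List.ofFn fun u => (q u, r u))
  have h1 : pairDepth (List.ofFn fun u => (q u, r u)) = ∑ u, r u := by
    rw [pairDepth, List.map_ofFn, List.sum_ofFn]
    rfl
  have h2 : pairWeight (List.ofFn fun u => (q u, r u)) = (∑ u, r u) + (∑ u, q u) + n := by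
    rw [pairWeight, List.map_ofFn, List.map_ofFn, List.sum_ofFn, List.sum_ofFn, List.length_ofFn,
      add_comm (∑ u, r u)]
    rfl
  rw [h1, h2] at h
  exact h

theorem mul_mem_productsPiTA (e p : ℕ) {w d : ℕ} {g : Icc (0 : ℝ) Real.pi → ℂ}
    (hg : g ∈ Submodule.span ℚ (productsTA w d)) :
    (fun σ => Complex.I ^ e * ((Real.pi : ℂ) * Complex.I) ^ p * g σ) ∈
      Submodule.span ℚ (productsPiTA e (p + w) (p + d)) := by
  refine Submodule.span_induction
    (p := fun (g : Icc (0 : ℝ) Real.pi → ℂ) _ =>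
      (fun σ => Complex.I ^ e * ((Real.pi : ℂ) * Complex.I) ^ p * g σ) ∈
      Submodule.span ℚ (productsPiTA e (p + w) (p + d)))
    ?_ (by simp only [Pi.zero_apply, mul_zero]; exact zero_mem _)
    (fun x x' _ _ hx hx' => by simp only [Pi.add_apply, mul_add]; exact add_mem hx hx')
    (fun c x _ hx => by
      simp only [Pi.smul_apply, mul_smul_comm]; exact Submodule.smul_mem _ c hx) hg
  rintro _ ⟨m, k, k', hk, hk', rfl, rfl, rfl⟩
  refine Submodule.subset_span ⟨m, p, k, k', hk, hk', by omega, by omega, ?_⟩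
  funext σ
  ring

theorem Lt_mem {n : ℕ} (k l : Fin n → ℕ) (hkl : ∀ u, l u + 1 ≤ k u) :
    (fun σ : Icc (0 : ℝ) Real.pi => ((Lt k l (σ : ℝ) : ℝ) : ℂ)) ∈
      Submodule.span ℚ
        (productsPiTA ((∑ u, l u) + n) (∑ u, k u) (∑ u, (k u - 1 - l u))) := by
  have : (fun σ : Icc (0 : ℝ) Real.pi => ((Lt k l (σ : ℝ) : ℝ) : ℂ)) =
      ∑ a ∈ Fintype.piFinset fun u => Finset.HasAntidiagonal.antidiagonal (k u - 1 - l u),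
        fun σ : Icc (0 : ℝ) Real.pi =>
        (((-1) ^ ((∑ u, k u) + n) * (∏ u, (Nat.factorial (k u - 1 - l u) : ℚ) /
            ((Nat.factorial (a u).1 : ℚ) * (Nat.factorial (a u).2 : ℚ))) *
            (-(1 / 2)) ^ (∑ u, (a u).1) : ℚ) : ℂ) *
          (Complex.I ^ ((∑ u, l u) + n) * ((Real.pi : ℂ) * Complex.I) ^ (∑ u, (a u).1) *
            FTilde l (fun u => (a u).2) σ) := by
    rw [Finset.sum_fn]
    funext σ
    rw [Lt_eq n k l hkl σ σ.2, Finset.mul_sum]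
    refine Finset.sum_congr rfl fun a _ => ?_
    have h1 : (-((Real.pi : ℂ) / 2) * Complex.I) = -(1 / 2) * ((Real.pi : ℂ) * Complex.I) := by
      ring
    rw [h1, mul_pow]
    push_cast
    ring
  rw [this]
  refine Submodule.sum_mem _ fun a ha => ratCast_mul_fun_mem _ ?_
  rw [Fintype.mem_piFinset] at ha
  have h1 : ∀ u, (a u).1 + (a u).2 = k u - 1 - l u := fun u =>
    Finset.HasAntidiagonal.mem_antidiagonal.1 (ha u)
  have h2 : (∑ u, (a u).1) + ∑ u, (a u).2 = ∑ u, (k u - 1 - l u) := by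
    rw [← Finset.sum_add_distrib]
    exact Finset.sum_congr rfl fun u _ => h1 u
  have h3 : (∑ u, (a u).1) + ((∑ u, (a u).2) + (∑ u, l u) + n) = ∑ u, k u := by
    have h4 : ∑ u : Fin n, ((a u).1 + ((a u).2 + l u + 1)) = ∑ u, k u :=
      Finset.sum_congr rfl fun u _ => by have := h1 u; have := hkl u; omega
    simpa [Finset.sum_add_distrib] using h4
  have h5 := mul_mem_productsPiTA ((∑ u, l u) + n) (∑ u, (a u).1)
    (FTilde_mem l fun u => (a u).2)
  rwa [h2, h3] at h5

end LogTan

theorem mainTheorem2 (n : ℕ) (k l : Fin n → ℕ) (hkl : ∀ u, l u + 1 ≤ k u) :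
    (∀ σ ∈ Set.Icc (0 : ℝ) Real.pi,
      (LogTan.Lt k l σ : ℂ) =
        (-1) ^ ((∑ u, k u) + n) * Complex.I ^ ((∑ u, l u) + n) *
          ∑ a ∈ Fintype.piFinset fun u => Finset.HasAntidiagonal.antidiagonal (k u - 1 - l u),
            (∏ u, (Nat.factorial (k u - 1 - l u) : ℂ) /
              ((Nat.factorial (a u).1 : ℂ) * (Nat.factorial (a u).2 : ℂ))) *
            (-((Real.pi : ℂ) / 2) * Complex.I) ^ (∑ u, (a u).1) *
            LogTan.FTilde l (fun u => (a u).2) σ) ∧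
    (∀ r : Fin n → ℕ,
      (fun σ : Set.Icc (0 : ℝ) Real.pi => LogTan.FTilde l r (σ : ℝ)) ∈
        Submodule.span ℚ
          (LogTan.productsTA ((∑ u, r u) + (∑ u, l u) + n) (∑ u, r u))) ∧
    (fun σ : Set.Icc (0 : ℝ) Real.pi => ((LogTan.Lt k l (σ : ℝ) : ℝ) : ℂ)) ∈
      Submodule.span ℚ
        (LogTan.productsPiTA ((∑ u, l u) + n) (∑ u, k u) (∑ u, (k u - 1 - l u))) :=

  ⟨LogTan.Lt_eq n k l hkl, fun r => LogTan.FTilde_mem l r, LogTan.Lt_mem k l hkl⟩
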